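/- Superoperators on a finite-dimensional Hilbert space are completely positive trace-non-increasing linear maps; write \(\|A\|_1\) for the trace norm, \([\![P]\!]\) for the denotational semantics of a (noisy) quantum while-program, with \([\![\mathbf{while}\cdots]\!]\rho=\bigsqcup_k[\![\mathbf{while}^{(k)}]\!]\rho\) in the Löwner order \(\sqsubseteq\), and \[ \|\mathcal E-\mathcal F\|_{Q,\lambda}=\sup\Big\{\tfrac12\big\|(\mathcal E\otimes I_{\mathcal A})(\rho)-(\mathcal F\otimes I_{\mathcal A})(\rho)\big\|_1 : \rho\ge 0,\ \operatorname{tr}\rho=1,\ \operatorname{tr}((Q\otimes I_{\mathcal A})\rho)\ge\lambda\Big\}, \] where \(\rho\) ranges over operators on \(\mathcal H\otimes\mathcal A\), \(\mathcal A\) any finite-dimensional auxiliary space, and \(\|\cdot\|_\diamond\) is the same supremum without the last constraint. A noisy program \(\widetilde P\), with ideal program \(P\) (all gate noise removed), is \(\epsilon\)-robust under \((Q,\lambda)\) if \(\|[\![\widetilde P]\!]-[\![P]\!]\|_{Q,\lambda}\le\epsilon\). The noisy statement \(\bar q:\cong_{p,\Phi}U[\bar q]\) has semantics \(\rho\mapsto(1-p)U\rho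 U^\dagger+p\,\Phi(\rho)\). A loop \(\mathbf{while}\ M[\bar q]=1\ \mathbf{do}\ P_1\) is \((a,n)\)-bounded (\(0\le a<1\), \(n\ge1\)) if \((\mathcal E^*)^n(M_1^\dagger M_1)\sqsubseteq aM_1^\dagger M_1\), where \(\mathcal E(\rho)=[\![P_1]\!](M_1\rho M_1^\dagger)\) and \(\mathcal E^*\) is its dual, \(\operatorname{tr}(A\,\mathcal E(\rho))=\operatorname{tr}(\mathcal E^*(A)\rho)\). Let \(p,p_V,p_U\in[0,1]\), let \(V=\begin{pmatrix}\sqrt p&-\sqrt{1-p}\\ \sqrt{1-p}&\sqrt p\end{pmatrix}\) and \(U=|01\rangle\langle\phi^+|+|00\rangle\langle\phi^-|+|10\rangle\langle\psi^+|+|11\rangle\langle\psi^-|\), where \(|\phi^\pm\rangle=\frac{1}{\sqrt2}(|00\rangle\pm|11\rangle)\), \(|\psi^\pm\rangle=\frac1{\sqrt2}(|01\rangle\pm|10\rangle)\). Let \(\Phi_V\) be any superoperator on one qubit and \(\Phi_U\) any superoperator on two qubits. The noisy quantum Bernoulli factory on two qubits \(q_1,q_2\) is \[ \begin{aligned} \widetilde{QBF}\equiv{}&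 q_1:=|1\rangle;\ q_2:=|1\rangle;\ \mathbf{while}\ M[q_2]=1\ \mathbf{do}\ \{\,q_1:=|0\rangle;\ q_2:=|0\rangle;\\ & q_1:\cong_{p_V,\Phi_V}V[q_1];\ q_2:\cong_{p_V,\Phi_V}V[q_2];\ q_1,q_2:\cong_{p_U,\Phi_U}U[q_1,q_2]\,\}, \end{aligned} \] where \(M=\{|0\rangle\langle0|,|1\rangle\langle1|\}\) and \(q:=|1\rangle\) stands for \(q:=|0\rangle\) followed by a noise-free \(X\) gate on \(q\). Let \(M_1=I\otimes|1\rangle\langle1|\), \(\epsilon_V=p_V\|\Phi_V-V\circ V^\dagger\|_\diamond\) and \(\epsilon_U=p_U\|\Phi_U-U\circ U^\dagger\|_\diamond\). Then: 1. For the loop of the ideal program, \(\mathcal E^*(M_1^\dagger M_1)=\frac12M_1^\dagger M_1\); in particular, this loop is \((\frac12,1)\)-bounded. 2. \(\widetilde{QBF}\) is \((4\epsilon_V+2\epsilon_U)\)-robust under \((I,0)\). -/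

import Mathlib

open scoped ComplexOrder MatrixOrder ENNReal Kronecker

namespace QWhile

noncomputable section

/-! Superoperators, trace distance and the diamond distance. -/

section Superoperators

variable {ι : Type} [Fintype ι] [DecidableEq ι]

/-- The superoperator `K ∘ K†`, that is `ρ ↦ K ρ K†`. -/
def conj (K : Matrix ι ι ℂ) : Matrix ι ι ℂ →ₗ[ℂ] Matrix ι ι ℂ :=
  LinearMap.mulLeft ℂ K ∘ₗ LinearMap.mulRight ℂ K.conjTranspose

/-- `(E ⊗ I_A)(ρ)` for an operator `ρ` on `H ⊗ A`: `E` is applied to every block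
`(1 ⊗ ⟨a|) ρ (1 ⊗ |b⟩)`. -/
def ampl (A : Type) (E : Matrix ι ι ℂ →ₗ[ℂ] Matrix ι ι ℂ) (ρ : Matrix (ι × A) (ι × A) ℂ) :
    Matrix (ι × A) (ι × A) ℂ :=
  Matrix.of fun x y => E (ρ.submatrix (fun i => (i, x.2)) (fun j => (j, y.2))) x.1 y.1

variable (ι) in
/-- Admissible superoperators: linear, completely positive and trace-non-increasing. -/
structure Superoperator where
  /-- the underlying linear map on operators -/
  map : Matrix ι ι ℂ →ₗ[ℂ] Matrix ι ι ℂ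
  completely_positive : ∀ (A : Type) [Fintype A] (ρ : Matrix (ι × A) (ι × A) ℂ),
    ρ.PosSemidef → (ampl A map ρ).PosSemidef
  trace_le : ∀ ρ : Matrix ι ι ℂ, ρ.PosSemidef → (map ρ).trace.re ≤ ρ.trace.re

variable (ι) in
/-- The identity superoperator. -/
def Superoperator.identity : Superoperator ι where
  map := LinearMap.id
  completely_positive := fun _ _ _ h => h
  trace_le := fun _ _ => le_rfl

/-- The trace norm of a Hermitian operator: the sum of the absolute values of its eigenvalues,
counted with multiplicity. -/
def traceNorm (A : Matrix ι ι ℂ) : ℝ := (A.charpoly.roots.map fun z => ‖z‖).sum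

/-- The trace distance. -/
def traceDist (ρ σ : Matrix ι ι ℂ) : ℝ := traceNorm (ρ - σ) / 2

/-- The `(Q, lam)`-diamond distance of `E` and `F`: the supremum, over all finite-dimensional
auxiliary spaces `A` and all density operators `ρ` on `H ⊗ A` with `tr (Q ρ) ≥ lam`, of the trace
distance of `(E ⊗ I_A)(ρ)` and `(F ⊗ I_A)(ρ)`. -/
def qDiamondDist (E F : Matrix ι ι ℂ →ₗ[ℂ] Matrix ι ι ℂ) (Q : Matrix ι ι ℂ) (lam : ℝ) : ℝ≥0∞ :=
  ⨆ (A : Type) (_ : Fintype A) (_ : DecidableEq A) (ρ : Matrix (ι × A) (ι × A) ℂ)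
    (_ : ρ.PosSemidef ∧ ρ.trace = 1 ∧ lam ≤ ((Q ⊗ₖ (1 : Matrix A A ℂ)) * ρ).trace.re),
    ENNReal.ofReal (traceDist (ampl A E ρ) (ampl A F ρ))

/-- The diamond distance of `E` and `F`: the same supremum over all density operators. -/
def diamondDist (E F : Matrix ι ι ℂ →ₗ[ℂ] Matrix ι ι ℂ) : ℝ≥0∞ :=
  ⨆ (A : Type) (_ : Fintype A) (_ : DecidableEq A) (ρ : Matrix (ι × A) (ι × A) ℂ)
    (_ : ρ.PosSemidef ∧ ρ.trace = 1),
    ENNReal.ofReal (traceDist (ampl A E ρ) (ampl A F ρ))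

/-- The dual map `E*`, determined by `tr (A E(ρ)) = tr (E*(A) ρ)` for all `ρ`
(see `trace_dual_mul`). -/
def dual (E : Matrix ι ι ℂ →ₗ[ℂ] Matrix ι ι ℂ) (A : Matrix ι ι ℂ) : Matrix ι ι ℂ :=
  Matrix.of fun i j => (A * E (Matrix.single j i 1)).trace

theorem trace_dual_mul (E : Matrix ι ι ℂ →ₗ[ℂ] Matrix ι ι ℂ) (A ρ : Matrix ι ι ℂ) :
    (dual E A * ρ).trace = (A * E ρ).trace := by
  conv_rhs => rw [Matrix.matrix_eq_sum_single ρ]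
  simp only [map_sum, Matrix.mul_sum, Matrix.trace_sum]
  rw [Finset.sum_comm]
  simp only [Matrix.trace, Matrix.diag, Matrix.mul_apply, dual, Matrix.of_apply]
  refine Finset.sum_congr rfl fun i _ => Finset.sum_congr rfl fun j _ => ?_
  have h : Matrix.single j i (ρ j i) = ρ j i • Matrix.single j i (1 : ℂ) := by
    simp [Matrix.smul_single]
  rw [h, map_smul, Finset.sum_mul]
  refine Finset.sum_congr rfl fun k _ => ?_
  rw [Finset.sum_mul]
  refine Finset.sum_congr rfl fun l _ => ?_
  simp only [Matrix.smul_apply, smul_eq_mul]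
  ring

/-- One round of a loop with guard operator `M₁` and body `E`: `ρ ↦ E(M₁ ρ M₁†)`. -/
def loopStep (M₁ : Matrix ι ι ℂ) (E : Matrix ι ι ℂ →ₗ[ℂ] Matrix ι ι ℂ) :
    Matrix ι ι ℂ →ₗ[ℂ] Matrix ι ι ℂ := E ∘ₗ conj M₁

/-- The meaning of the `k`-th syntactic approximation `while^(k)` of a loop with measurement
`{M₀, M₁}` and body `E`: `while^(0)` aborts, and `while^(k+1)` measures, stops on outcome `0`, and
runs the body followed by `while^(k)` on outcome `1`. -/
def whileApprox (M₀ M₁ : Matrix ι ι ℂ) (E : Matrix ι ι ℂ →ₗ[ℂ] Matrix ι ι ℂ) :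
    ℕ → (Matrix ι ι ℂ →ₗ[ℂ] Matrix ι ι ℂ)
  | 0 => 0
  | k + 1 => conj M₀ + whileApprox M₀ M₁ E k ∘ₗ loopStep M₁ E

/-- `L` sends each partial density operator `ρ` to the least upper bound, in the Löwner order, of
the values at `ρ` of the approximations of the loop. -/
def IsWhileSem (M₀ M₁ : Matrix ι ι ℂ) (E L : Matrix ι ι ℂ →ₗ[ℂ] Matrix ι ι ℂ) : Prop :=
  ∀ ρ : Matrix ι ι ℂ, ρ.PosSemidef → ρ.trace.re ≤ 1 →
    IsLUB (Set.range fun k => whileApprox M₀ M₁ E k ρ) (L ρ)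

open Classical in
/-- The meaning of a loop: the superoperator `ρ ↦ ⨆ₖ while^(k)(ρ)`. (A linear map is determined by
its values on partial density operators; the least upper bounds exist and depend linearly on `ρ`
whenever `E` is an admissible superoperator and `M₀†M₀ + M₁†M₁ = 1`.) -/
def whileSem (M₀ M₁ : Matrix ι ι ℂ) (E : Matrix ι ι ℂ →ₗ[ℂ] Matrix ι ι ℂ) :
    Matrix ι ι ℂ →ₗ[ℂ] Matrix ι ι ℂ :=
  if h : ∃ L, IsWhileSem M₀ M₁ E L then h.choose else 0

end Superoperators

/-! Registers of qubits. -/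

/-- The labels of the computational basis of `n` qubits. -/
abbrev Qubits (n : ℕ) : Type := Fin n → Fin 2

/-- Operators on `n` qubits. -/
abbrev Op (n : ℕ) : Type := Matrix (Qubits n) (Qubits n) ℂ

/-- Unitary operators on `n` qubits. -/
abbrev Unitary (n : ℕ) : Type := Matrix.unitaryGroup (Qubits n) ℂ

/-- The register consisting of the single variable `q`. -/
def reg₁ {n : ℕ} (q : Fin n) : Fin 1 ↪ Fin n :=
  ⟨fun _ => q, Function.injective_of_subsingleton _⟩

/-- A one-qubit operator, given as a `2 × 2` matrix. -/
def qubitOp (A : Matrix (Fin 2) (Fin 2) ℂ) : Op 1 :=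
  Matrix.of fun s t => A (s 0) (t 0)

open Classical in
/-- The operator `A` applied to the register `r`, with the identity on all other variables. -/
def liftOp {n k : ℕ} (r : Fin k ↪ Fin n) (A : Op k) : Op n :=
  Matrix.of fun s t =>
    if ∀ v, v ∉ Set.range r → s v = t v then A (fun i => s (r i)) (fun i => t (r i)) else 0

/-- The superoperator `E` applied to the register `r`, with the identity on all other variables.
Here `Function.extend r a s` is the basis label `s` with its values on `r` replaced by `a`. -/
def liftSuper {n k : ℕ} (r : Fin k ↪ Fin n) (E : Op k →ₗ[ℂ] Op k) : Op n →ₗ[ℂ] Op n where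
  toFun ρ := Matrix.of fun s t =>
    E (ρ.submatrix (fun a => Function.extend r a s) (fun b => Function.extend r b t))
      (fun i => s (r i)) (fun i => t (r i))
  map_add' ρ σ := by
    ext s t
    simp [Matrix.submatrix_add]
  map_smul' c ρ := by
    ext s t
    simp [Matrix.submatrix_smul]

/-- The superoperator that resets the variable `q` to `|0⟩`:
`ρ ↦ |0⟩⟨0| ρ |0⟩⟨0| + |0⟩⟨1| ρ |1⟩⟨0|` on `q`. -/
def initSem {n : ℕ} (q : Fin n) : Op n →ₗ[ℂ] Op n :=
  ∑ x : Fin 2, conj (liftOp (reg₁ q) (qubitOp (Matrix.single 0 x 1)))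

/-! The quantum while-language over `n` qubit variables, ideal and noisy. -/

/-- Quantum while-programs. -/
inductive Prog (n : ℕ) : Type
  | skip : Prog n
  | init (q : Fin n) : Prog n
  | unitary {k : ℕ} (r : Fin k ↪ Fin n) (U : Unitary k) : Prog n
  | seq (P₁ P₂ : Prog n) : Prog n
  | case {k m : ℕ} (r : Fin k ↪ Fin n) (M : Fin m → Op k)
      (hM : ∑ i, (M i).conjTranspose * M i = 1) (P : Fin m → Prog n) : Prog n
  | loop {k : ℕ} (r : Fin k ↪ Fin n) (M₀ M₁ : Op k)
      (hM : M₀.conjTranspose * M₀ + M₁.conjTranspose * M₁ = 1) (P₁ : Prog n) : Prog n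

/-- Denotational semantics of quantum while-programs. -/
def Prog.sem {n : ℕ} : Prog n → (Op n →ₗ[ℂ] Op n)
  | .skip => LinearMap.id
  | .init q => initSem q
  | .unitary r U => conj (liftOp r (U : Op _))
  | .seq P₁ P₂ => P₂.sem ∘ₗ P₁.sem
  | .case r M _ P => ∑ i, (P i).sem ∘ₗ conj (liftOp r (M i))
  | .loop r M₀ M₁ _ P₁ => whileSem (liftOp r M₀) (liftOp r M₁) P₁.sem

/-- Noisy quantum while-programs: the statement `unitary r U p Φ` applies `U` to the register `r`
with probability `1 - p`, and the superoperator `Φ` with probability `p`. -/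
inductive NoisyProg (n : ℕ) : Type
  | skip : NoisyProg n
  | init (q : Fin n) : NoisyProg n
  | unitary {k : ℕ} (r : Fin k ↪ Fin n) (U : Unitary k) (p : unitInterval)
      (Φ : Superoperator (Qubits k)) : NoisyProg n
  | seq (P₁ P₂ : NoisyProg n) : NoisyProg n
  | case {k m : ℕ} (r : Fin k ↪ Fin n) (M : Fin m → Op k)
      (hM : ∑ i, (M i).conjTranspose * M i = 1) (P : Fin m → NoisyProg n) : NoisyProg n
  | loop {k : ℕ} (r : Fin k ↪ Fin n) (M₀ M₁ : Op k)
      (hM : M₀.conjTranspose * M₀ + M₁.conjTranspose * M₁ = 1) (P₁ : NoisyProg n) : NoisyProg n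

/-- Denotational semantics of noisy quantum while-programs. -/
def NoisyProg.sem {n : ℕ} : NoisyProg n → (Op n →ₗ[ℂ] Op n)
  | .skip => LinearMap.id
  | .init q => initSem q
  | .unitary r U p Φ =>
      ((1 - (p : ℝ) : ℝ) : ℂ) • conj (liftOp r (U : Op _)) + ((p : ℝ) : ℂ) • liftSuper r Φ.map
  | .seq P₁ P₂ => P₂.sem ∘ₗ P₁.sem
  | .case r M _ P => ∑ i, (P i).sem ∘ₗ conj (liftOp r (M i))
  | .loop r M₀ M₁ _ P₁ => whileSem (liftOp r M₀) (liftOp r M₁) P₁.sem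

/-- The ideal program of a noisy program. -/
def NoisyProg.ideal {n : ℕ} : NoisyProg n → Prog n
  | .skip => .skip
  | .init q => .init q
  | .unitary r U _ _ => .unitary r U
  | .seq P₁ P₂ => .seq P₁.ideal P₂.ideal
  | .case r M hM P => .case r M hM fun i => (P i).ideal
  | .loop r M₀ M₁ hM P₁ => .loop r M₀ M₁ hM P₁.ideal

/-- A program is an `(a, N)`-bounded loop if it is `while M[r] = 1 do P₁` with
`(E*)^N (M₁†M₁) ⊑ a M₁†M₁`, where `E(ρ) = ⟦P₁⟧(M₁ ρ M₁†)`, `0 ≤ a < 1` and `1 ≤ N`. -/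
def Prog.IsBounded {n : ℕ} : Prog n → ℝ → ℕ → Prop
  | .loop r _ M₁ _ P₁, a, N =>
      0 ≤ a ∧ a < 1 ∧ 1 ≤ N ∧
        (dual (loopStep (liftOp r M₁) P₁.sem))^[N] ((liftOp r M₁).conjTranspose * liftOp r M₁) ≤
          (a : ℂ) • ((liftOp r M₁).conjTranspose * liftOp r M₁)
  | _, _, _ => False

/-- The noisy program `P` is `ε`-robust under `(Q, lam)`. -/
def NoisyProg.IsRobust {n : ℕ} (P : NoisyProg n) (Q : Op n) (lam ε : ℝ) : Prop :=
  0 ≤ ε ∧ qDiamondDist P.sem P.ideal.sem Q lam ≤ ENNReal.ofReal ε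

/-! The noisy quantum Bernoulli factory. The variables `q₁`, `q₂` are `0`, `1 : Fin 2`. -/

/-- The basis projector `|i⟩⟨i|` of a qubit. -/
def proj (i : Fin 2) : Op 1 := qubitOp (Matrix.single i i 1)

theorem proj_complete :
    (proj 0).conjTranspose * proj 0 + (proj 1).conjTranspose * proj 1 = 1 := by
  ext s t
  obtain ⟨a, rfl⟩ : ∃ a : Fin 2, s = fun _ => a := ⟨s 0, funext fun i => by fin_cases i; rfl⟩
  obtain ⟨b, rfl⟩ : ∃ b : Fin 2, t = fun _ => b := ⟨t 0, funext fun i => by fin_cases i; rfl⟩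
  simp only [Matrix.add_apply, Matrix.mul_apply, Matrix.conjTranspose_apply, proj, qubitOp,
    Matrix.of_apply, Matrix.one_apply]
  rw [← (Equiv.funUnique (Fin 1) (Fin 2)).symm.sum_comp,
    ← (Equiv.funUnique (Fin 1) (Fin 2)).symm.sum_comp]
  fin_cases a <;> fin_cases b <;> simp [Matrix.single_apply, funext_iff]

theorem qubitOp_unitary {A : Matrix (Fin 2) (Fin 2) ℂ} (h : A * A.conjTranspose = 1) :
    qubitOp A ∈ Matrix.unitaryGroup (Qubits 1) ℂ := by
  rw [Matrix.mem_unitaryGroup_iff, Matrix.star_eq_conjTranspose]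
  ext s t
  have h' := congrFun (congrFun h (s 0)) (t 0)
  simp only [Matrix.mul_apply, Matrix.conjTranspose_apply, Matrix.one_apply] at h' ⊢
  rw [← (Equiv.funUnique (Fin 1) (Fin 2)).symm.sum_comp]
  have e : s = t ↔ s 0 = t 0 :=
    ⟨fun h => by rw [h], fun h => funext fun i => by rw [Subsingleton.elim i 0]; exact h⟩
  simpa [qubitOp, e] using h'

/-- The Pauli `X` gate. -/
def gateX : Unitary 1 :=
  ⟨qubitOp !![0, 1; 1, 0], qubitOp_unitary (by
    ext i j; fin_cases i <;> fin_cases j <;> simp [Matrix.mul_apply])⟩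

/-- The gate `V = [[√p, -√(1-p)], [√(1-p), √p]]`, which maps `|0⟩` to `√p |0⟩ + √(1-p) |1⟩`. -/
def gateV (p : unitInterval) : Unitary 1 :=
  ⟨qubitOp !![(√(p : ℝ) : ℂ), -(√(1 - (p : ℝ)) : ℂ); (√(1 - (p : ℝ)) : ℂ), (√(p : ℝ) : ℂ)],
    qubitOp_unitary (by
      have h₁ : (√(p : ℝ) : ℂ) * (√(p : ℝ) : ℂ) = ((p : ℝ) : ℂ) := by
        rw [← Complex.ofReal_mul, Real.mul_self_sqrt p.2.1]
      have h₂ : (√(1 - (p : ℝ)) : ℂ) * (√(1 - (p : ℝ)) : ℂ) = ((1 - (p : ℝ) : ℝ) : ℂ) := by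
        rw [← Complex.ofReal_mul, Real.mul_self_sqrt (sub_nonneg.2 p.2.2)]
      ext i j
      fin_cases i <;> fin_cases j <;> simp [Matrix.mul_apply, h₁, h₂] <;> ring)⟩

/-- The basis vector `|ab⟩` of two qubits. -/
def ket (a b : Fin 2) : Qubits 2 → ℂ := Pi.single ![a, b] 1

/-- The Bell vectors `|φ^±⟩ = (|00⟩ ± |11⟩)/√2` for `c = ±1`. -/
def bellPhi (c : ℂ) : Qubits 2 → ℂ := (1 / (√2 : ℝ) : ℂ) • (ket 0 0 + c • ket 1 1)

/-- The Bell vectors `|ψ^±⟩ = (|01⟩ ± |10⟩)/√2` for `c = ±1`. -/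
def bellPsi (c : ℂ) : Qubits 2 → ℂ := (1 / (√2 : ℝ) : ℂ) • (ket 0 1 + c • ket 1 0)

/-- The outer product `|x⟩⟨y|`. -/
def ketbra (x y : Qubits 2 → ℂ) : Op 2 := Matrix.vecMulVec x (star y)

/-- The operator `|01⟩⟨φ⁺| + |00⟩⟨φ⁻| + |10⟩⟨ψ⁺| + |11⟩⟨ψ⁻|`. -/
def matU : Op 2 :=
  ketbra (ket 0 1) (bellPhi 1) + ketbra (ket 0 0) (bellPhi (-1)) +
    ketbra (ket 1 0) (bellPsi 1) + ketbra (ket 1 1) (bellPsi (-1))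

theorem matU_unitary : matU ∈ Matrix.unitaryGroup (Qubits 2) ℂ := by
  rw [Matrix.mem_unitaryGroup_iff, Matrix.star_eq_conjTranspose]
  have h2 : ((√2 : ℝ) : ℂ)⁻¹ * ((√2 : ℝ) : ℂ)⁻¹ = 1 / 2 := by
    rw [← mul_inv, ← Complex.ofReal_mul, Real.mul_self_sqrt (by norm_num)]
    norm_num
  ext s t
  obtain ⟨⟨a, b⟩, rfl⟩ := (finTwoArrowEquiv (Fin 2)).symm.surjective s
  obtain ⟨⟨c, d⟩, rfl⟩ := (finTwoArrowEquiv (Fin 2)).symm.surjective t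
  rw [Matrix.mul_apply, ← (finTwoArrowEquiv (Fin 2)).symm.sum_comp, Fintype.sum_prod_type]
  fin_cases a <;> fin_cases b <;> fin_cases c <;> fin_cases d <;>
    simp [matU, ketbra, bellPhi, bellPsi, ket, Matrix.vecMulVec_apply,
      Pi.single_apply, funext_iff, Fin.forall_fin_two, h2] <;> norm_num

/-- The gate `U = |01⟩⟨φ⁺| + |00⟩⟨φ⁻| + |10⟩⟨ψ⁺| + |11⟩⟨ψ⁻|`. -/
def gateU : Unitary 2 := ⟨matU, matU_unitary⟩

/-- The register `q₁, q₂`. -/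
def reg₁₂ : Fin 2 ↪ Fin 2 := Function.Embedding.refl _

/-- The noise-free statement `q := |1⟩`, that is `q := |0⟩; q := X[q]` with error
probability `0`. -/
def initOne (q : Fin 2) : NoisyProg 2 :=
  .seq (.init q) (.unitary (reg₁ q) gateX 0 (Superoperator.identity _))

/-- The loop body `q₁ := |0⟩; q₂ := |0⟩; q₁ ≅ V[q₁]; q₂ ≅ V[q₂]; q₁,q₂ ≅ U[q₁,q₂]`. -/
def qbfBody (p pV pU : unitInterval) (ΦV : Superoperator (Qubits 1))
    (ΦU : Superoperator (Qubits 2)) : NoisyProg 2 :=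
  .seq (.init 0) <| .seq (.init 1) <| .seq (.unitary (reg₁ 0) (gateV p) pV ΦV) <|
    .seq (.unitary (reg₁ 1) (gateV p) pV ΦV) (.unitary reg₁₂ gateU pU ΦU)

/-- The loop `while M[q₂] = 1 do body`, `M` the measurement of `q₂` in the computational basis. -/
def qbfLoop (p pV pU : unitInterval) (ΦV : Superoperator (Qubits 1))
    (ΦU : Superoperator (Qubits 2)) : NoisyProg 2 :=
  .loop (reg₁ 1) (proj 0) (proj 1) proj_complete (qbfBody p pV pU ΦV ΦU)

/-- The noisy quantum Bernoulli factory `q₁ := |1⟩; q₂ := |1⟩; while M[q₂] = 1 do body`. -/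
def qbf (p pV pU : unitInterval) (ΦV : Superoperator (Qubits 1))
    (ΦU : Superoperator (Qubits 2)) : NoisyProg 2 :=
  .seq (initOne 0) (.seq (initOne 1) (qbfLoop p pV pU ΦV ΦU))

/-- The operator `M₁ = I ⊗ |1⟩⟨1|`. -/
def qbfM₁ : Op 2 := liftOp (reg₁ 1) (proj 1)

/-- The error `p ‖Φ - U ∘ U†‖_⋄` of a noisy gate. -/
def gateError {k : ℕ} (U : Unitary k) (p : unitInterval) (Φ : Superoperator (Qubits k)) : ℝ :=
  (p : ℝ) * (diamondDist Φ.map (conj (U : Op k))).toReal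

end

end QWhile

/-!
Three facts carry the theorem.

*The ideal loop halves the weight of its guard.* The two resets of the ideal body send `X` to
`tr X • |00⟩⟨00|`, so the body outputs `tr X • |w⟩⟨w|` with `w = U (v ⊗ v)` and
`v = √p |0⟩ + √(1-p) |1⟩`. The amplitude of `w` at `|01⟩` is `⟨φ⁺|v ⊗ v⟩ = (p + (1 - p)) / √2`, and
at `|11⟩` it is `⟨ψ⁻|v ⊗ v⟩ = 0`; hence the guard holds after the body with probability `1/2`,
whatever `p` and the input are (`trace_guard_ideal_qbfBody`). This gives the identity for the dual
map and boundedness of the loop.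

*The body is moved by at most `2 ε_V + ε_U`.* Errors add up along compositions of superoperators
(`DistLE.comp`), and the diamond distance of two maps on a register bounds the distance of their
extensions to all variables, the other variables being part of the auxiliary space
(`ampl_liftSuper`).

*A loop multiplies the error of its body by `1 / (1 - a)`.* For the approximations `W'ₖ`, `Wₖ` of
loops with bodies `E'`, `E` and a common measurement,
`W'ₖ₊₁ - Wₖ₊₁ = W'ₖ (E' - E) (M₁ · M₁†) + (W'ₖ - Wₖ) E (M₁ · M₁†)`. The first term has trace norm at
most the error of the body times `tr (M₁†M₁ ρ)`; in the second, `E` shrinks this weight by the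
factor `a`, and the errors form a geometric series (`traceBound_whileApprox_sub`). With `a = 1/2`
the factor is `2`. The bound passes to the meaning of the loops because the approximations converge
to it: they increase in the Löwner order and have bounded traces (`tendsto_whileApprox`).

Bounds on trace norms are handled through `TraceBound`, the existence of a decomposition into a
difference of positive matrices, which is preserved by superoperators. The passage to the limit
uses the dual description of the trace norm as a pairing with the sign of the matrix
(`traceNorm_le_of_tendsto`).
-/

namespace QWhile

open Matrix Filter Topology

/-! ### Positive semidefinite matrices and the trace norm -/

section TraceNorm

variable {ι κ : Type} [Fintype ι] [Fintype κ]

theorem trace_re_nonneg {A : Matrix ι ι ℂ} (hA : A.PosSemidef) : 0 ≤ A.trace.re :=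
  (Complex.nonneg_iff.1 hA.trace_nonneg).1

theorem ofReal_trace_re {A : Matrix ι ι ℂ} (hA : A.PosSemidef) : (A.trace.re : ℂ) = A.trace :=
  (Complex.eq_re_of_ofReal_le (r := 0) (by simpa using hA.trace_nonneg)).symm

theorem trace_submatrix_equiv (A : Matrix ι ι ℂ) (e : κ ≃ ι) :
    (A.submatrix e e).trace = A.trace := by
  simp only [trace, diag, submatrix_apply]
  exact e.sum_comp fun i => A i i

theorem diag_re_le_trace_re {A : Matrix ι ι ℂ} (hA : A.PosSemidef) (i : ι) :
    (A i i).re ≤ A.trace.re := by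
  rw [trace, Complex.re_sum]
  exact Finset.single_le_sum (f := fun i => (A i i).re)
    (fun j _ => (Complex.nonneg_iff.1 (hA.diag_nonneg (i := j))).1) (Finset.mem_univ i)

/-- The `2 × 2` minors of a positive semidefinite matrix bound its entries by its trace. -/
theorem norm_apply_le_trace_re {A : Matrix ι ι ℂ} (hA : A.PosSemidef) (i j : ι) :
    ‖A i j‖ ≤ A.trace.re := by
  have hdet := (hA.submatrix ![i, j]).det_nonneg
  have hji : A j i = star (A i j) := (hA.1.apply j i).symm
  have hi := Complex.nonneg_iff.1 (hA.diag_nonneg (i := i))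
  have hj := Complex.nonneg_iff.1 (hA.diag_nonneg (i := j))
  have hdet' := (Complex.nonneg_iff.1 hdet).1
  simp only [det_fin_two, submatrix_apply, cons_val_zero, cons_val_one, hji, Complex.star_def,
    Complex.mul_conj, Complex.sub_re, Complex.mul_re, ← hi.2, ← hj.2, Complex.ofReal_re,
    Complex.normSq_eq_norm_sq] at hdet'
  have h1 := diag_re_le_trace_re hA i
  have h2 := diag_re_le_trace_re hA j
  refine abs_le_of_sq_le_sq' ?_ (trace_re_nonneg hA) |>.2
  have := mul_le_mul h1 h2 hj.1 (trace_re_nonneg hA)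
  nlinarith

theorem eq_zero_of_trace_re_eq_zero {A : Matrix ι ι ℂ} (hA : A.PosSemidef)
    (h : A.trace.re = 0) : A = 0 := by
  ext i j
  exact norm_le_zero_iff.1 ((norm_apply_le_trace_re hA i j).trans h.le)

theorem isClosed_posSemidef : IsClosed {A : Matrix ι ι ℂ | A.PosSemidef} := by
  classical
  have : {A : Matrix ι ι ℂ | A.PosSemidef} =
      {A | Aᴴ = A} ∩ ⋂ x : ι → ℂ, {A | 0 ≤ star x ⬝ᵥ (A *ᵥ x)} := by
    ext A
    simp only [Set.mem_ofPred_eq, Set.mem_inter_iff, Set.mem_iInter,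
      posSemidef_iff_dotProduct_mulVec]
    rfl
  rw [this]
  refine (isClosed_eq (by fun_prop) (by fun_prop)).inter (isClosed_iInter fun x => ?_)
  exact isClosed_le (by fun_prop) (by fun_prop)

theorem trace_mul_re_nonneg [DecidableEq ι] {A B : Matrix ι ι ℂ} (hA : A.PosSemidef)
    (hB : B.PosSemidef) : 0 ≤ (A * B).trace.re := by
  obtain ⟨C, rfl⟩ := CStarAlgebra.nonneg_iff_eq_star_mul_self.1 hA.nonneg
  rw [star_eq_conjTranspose, Matrix.mul_assoc, trace_mul_comm]
  exact trace_re_nonneg (hB.mul_mul_conjTranspose_same C)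

/-- `A` is a difference of positive semidefinite matrices whose traces add up to at most `c`.
For Hermitian `A` this says that the trace norm of `A` is at most `c`; it makes sense without
decidable equality, and is visibly preserved by positive trace-non-increasing maps. -/
def TraceBound (A : Matrix ι ι ℂ) (c : ℝ) : Prop :=
  ∃ P N : Matrix ι ι ℂ, P.PosSemidef ∧ N.PosSemidef ∧ A = P - N ∧ P.trace.re + N.trace.re ≤ c

theorem TraceBound.mono {A : Matrix ι ι ℂ} {c d : ℝ} (h : TraceBound A c) (hcd : c ≤ d) :
    TraceBound A d := by
  obtain ⟨P, N, hP, hN, rfl, hc⟩ := h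
  exact ⟨P, N, hP, hN, rfl, hc.trans hcd⟩

theorem TraceBound.zero : TraceBound (0 : Matrix ι ι ℂ) 0 :=
  ⟨0, 0, .zero, .zero, by simp, by simp⟩

theorem TraceBound.add {A B : Matrix ι ι ℂ} {c d : ℝ} (hA : TraceBound A c)
    (hB : TraceBound B d) : TraceBound (A + B) (c + d) := by
  obtain ⟨P, N, hP, hN, rfl, hc⟩ := hA
  obtain ⟨P', N', hP', hN', rfl, hd⟩ := hB
  refine ⟨P + P', N + N', hP.add hP', hN.add hN', by abel, ?_⟩
  simp only [trace_add, Complex.add_re]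
  linarith

theorem TraceBound.smul {A : Matrix ι ι ℂ} {c r : ℝ} (hA : TraceBound A c) (hr : 0 ≤ r) :
    TraceBound ((r : ℂ) • A) (r * c) := by
  obtain ⟨P, N, hP, hN, rfl, hc⟩ := hA
  have hr' : (0 : ℂ) ≤ r := by exact_mod_cast hr
  refine ⟨(r : ℂ) • P, (r : ℂ) • N, hP.smul hr', hN.smul hr', smul_sub _ _ _, ?_⟩
  simp only [trace_smul, smul_eq_mul, Complex.re_ofReal_mul]
  nlinarith

theorem TraceBound.submatrix {A : Matrix ι ι ℂ} {c : ℝ} (hA : TraceBound A c) (e : κ ≃ ι) :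
    TraceBound (A.submatrix e e) c := by
  obtain ⟨P, N, hP, hN, rfl, hc⟩ := hA
  refine ⟨P.submatrix e e, N.submatrix e e, hP.submatrix e, hN.submatrix e, rfl, ?_⟩
  rwa [trace_submatrix_equiv, trace_submatrix_equiv]

theorem TraceBound.isHermitian {A : Matrix ι ι ℂ} {c : ℝ} (hA : TraceBound A c) :
    A.IsHermitian := by
  obtain ⟨P, N, hP, hN, rfl, -⟩ := hA
  exact hP.1.sub hN.1

variable [DecidableEq ι]

theorem traceNorm_eq_sum_eigenvalues {A : Matrix ι ι ℂ} (hA : A.IsHermitian) :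
    traceNorm A = ∑ i, |hA.eigenvalues i| := by
  simp [traceNorm, hA.roots_charpoly_eq_eigenvalues]

/-- The matrix obtained from the Hermitian matrix `A` by applying `f` to its eigenvalues. -/
noncomputable def spectralApply {A : Matrix ι ι ℂ} (hA : A.IsHermitian) (f : ℝ → ℝ) :
    Matrix ι ι ℂ :=
  (hA.eigenvectorUnitary : Matrix ι ι ℂ) *
    diagonal (fun i => (f (hA.eigenvalues i) : ℂ)) * (hA.eigenvectorUnitary : Matrix ι ι ℂ)ᴴ

theorem spectralApply_id {A : Matrix ι ι ℂ} (hA : A.IsHermitian) :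
    spectralApply hA (fun x => x) = A := by
  conv_rhs => rw [hA.spectral_theorem]
  rfl

theorem spectralApply_sub {A : Matrix ι ι ℂ} (hA : A.IsHermitian) (f g : ℝ → ℝ) :
    spectralApply hA f - spectralApply hA g = spectralApply hA (fun x => f x - g x) := by
  simp only [spectralApply, ← Matrix.sub_mul, ← Matrix.mul_sub, diagonal_sub, Complex.ofReal_sub]

theorem spectralApply_add {A : Matrix ι ι ℂ} (hA : A.IsHermitian) (f g : ℝ → ℝ) :
    spectralApply hA f + spectralApply hA g = spectralApply hA (fun x => f x + g x) := by
  simp only [spectralApply, ← Matrix.add_mul, ← Matrix.mul_add, diagonal_add, Complex.ofReal_add]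

theorem spectralApply_one {A : Matrix ι ι ℂ} (hA : A.IsHermitian) :
    spectralApply hA (fun _ => 1) = 1 := by
  have : (hA.eigenvectorUnitary : Matrix ι ι ℂ) * (hA.eigenvectorUnitary : Matrix ι ι ℂ)ᴴ = 1 :=
    Unitary.coe_mul_star_self hA.eigenvectorUnitary
  simpa [spectralApply] using this

theorem spectralApply_mul {A : Matrix ι ι ℂ} (hA : A.IsHermitian) (f g : ℝ → ℝ) :
    spectralApply hA f * spectralApply hA g = spectralApply hA (fun x => f x * g x) := by
  have : (hA.eigenvectorUnitary : Matrix ι ι ℂ)ᴴ * (hA.eigenvectorUnitary : Matrix ι ι ℂ) = 1 :=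
    Unitary.coe_star_mul_self hA.eigenvectorUnitary
  simp only [spectralApply, Matrix.mul_assoc]
  rw [← Matrix.mul_assoc _ᴴ, this, Matrix.one_mul, ← Matrix.mul_assoc (diagonal _),
    diagonal_mul_diagonal]
  simp

theorem trace_spectralApply {A : Matrix ι ι ℂ} (hA : A.IsHermitian) (f : ℝ → ℝ) :
    (spectralApply hA f).trace.re = ∑ i, f (hA.eigenvalues i) := by
  have : (hA.eigenvectorUnitary : Matrix ι ι ℂ)ᴴ * (hA.eigenvectorUnitary : Matrix ι ι ℂ) = 1 :=
    Unitary.coe_star_mul_self hA.eigenvectorUnitary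
  rw [spectralApply, trace_mul_comm, ← Matrix.mul_assoc, this, Matrix.one_mul, trace_diagonal]
  simp

theorem posSemidef_spectralApply {A : Matrix ι ι ℂ} (hA : A.IsHermitian) {f : ℝ → ℝ}
    (hf : ∀ x, 0 ≤ f x) : (spectralApply hA f).PosSemidef := by
  refine PosSemidef.mul_mul_conjTranspose_same (PosSemidef.diagonal fun i => ?_) _
  simpa using hf _

/-- The Jordan decomposition attains the trace norm. -/
theorem traceBound_traceNorm {A : Matrix ι ι ℂ} (hA : A.IsHermitian) :
    TraceBound A (traceNorm A) := by
  refine ⟨spectralApply hA (fun x => x⁺), spectralApply hA (fun x => x⁻),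
    posSemidef_spectralApply hA fun x => posPart_nonneg x,
    posSemidef_spectralApply hA fun x => negPart_nonneg x, ?_, ?_⟩
  · simp only [spectralApply_sub, posPart_sub_negPart, spectralApply_id]
  · rw [trace_spectralApply, trace_spectralApply, ← Finset.sum_add_distrib,
      traceNorm_eq_sum_eigenvalues hA]
    simp only [posPart_add_negPart, le_refl]

/-- The trace norm of a Hermitian matrix is attained by pairing with a contraction `S`, the sign
of the matrix. -/
theorem exists_trace_mul_eq_traceNorm {A : Matrix ι ι ℂ} (hA : A.IsHermitian) :
    ∃ S : Matrix ι ι ℂ, (1 - S).PosSemidef ∧ (1 + S).PosSemidef ∧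
      (S * A).trace.re = traceNorm A := by
  refine ⟨spectralApply hA fun x => if 0 ≤ x then 1 else -1, ?_, ?_, ?_⟩
  · rw [← spectralApply_one hA, spectralApply_sub]
    refine posSemidef_spectralApply hA fun x => ?_
    split_ifs <;> norm_num
  · rw [← spectralApply_one hA, spectralApply_add]
    refine posSemidef_spectralApply hA fun x => ?_
    split_ifs <;> norm_num
  · nth_rw 2 [← spectralApply_id hA]
    rw [spectralApply_mul, trace_spectralApply, traceNorm_eq_sum_eigenvalues hA]
    refine Finset.sum_congr rfl fun i _ => ?_
    split_ifs with h
    · rw [one_mul, abs_of_nonneg h]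
    · rw [abs_of_neg (not_le.1 h)]
      ring

theorem TraceBound.trace_mul_re_le {A S : Matrix ι ι ℂ} {c : ℝ} (hA : TraceBound A c)
    (h₁ : (1 - S).PosSemidef) (h₂ : (1 + S).PosSemidef) : (S * A).trace.re ≤ c := by
  obtain ⟨P, N, hP, hN, rfl, hc⟩ := hA
  have hP' := trace_mul_re_nonneg h₁ hP
  have hN' := trace_mul_re_nonneg h₂ hN
  simp only [Matrix.sub_mul, Matrix.add_mul, Matrix.mul_sub, Matrix.one_mul, trace_sub, trace_add,
    Complex.sub_re, Complex.add_re] at hP' hN' ⊢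
  linarith

theorem TraceBound.traceNorm_le {A : Matrix ι ι ℂ} {c : ℝ} (hA : TraceBound A c) :
    traceNorm A ≤ c := by
  obtain ⟨S, h₁, h₂, h⟩ := exists_trace_mul_eq_traceNorm hA.isHermitian
  exact h ▸ hA.trace_mul_re_le h₁ h₂

/-- Trace norm bounds pass to limits: pair with the sign of the limit. -/
theorem traceNorm_le_of_tendsto {A : ℕ → Matrix ι ι ℂ} {B : Matrix ι ι ℂ} {c : ℝ}
    (h : ∀ k, TraceBound (A k) c) (hB : Tendsto A atTop (𝓝 B)) : traceNorm B ≤ c := by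
  have hH : B.IsHermitian := by
    have hstar : Tendsto (fun k => (A k)ᴴ) atTop (𝓝 Bᴴ) :=
      ((continuous_id.matrix_conjTranspose).tendsto B).comp hB
    simp only [(h _).isHermitian.eq] at hstar
    exact tendsto_nhds_unique hstar hB
  obtain ⟨S, h₁, h₂, hS⟩ := exists_trace_mul_eq_traceNorm hH
  have hc : Continuous fun X : Matrix ι ι ℂ => (S * X).trace.re := by fun_prop
  exact hS ▸ le_of_tendsto' ((hc.tendsto B).comp hB) fun k => (h k).trace_mul_re_le h₁ h₂

end TraceNorm

/-! ### Amplification, and superoperators -/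

section Ampl

variable {ι A : Type}

theorem ampl_sub (E : Matrix ι ι ℂ →ₗ[ℂ] Matrix ι ι ℂ) (ρ σ : Matrix (ι × A) (ι × A) ℂ) :
    ampl A E (ρ - σ) = ampl A E ρ - ampl A E σ := by
  ext x y
  simp [ampl, submatrix_sub]

theorem ampl_smul (E : Matrix ι ι ℂ →ₗ[ℂ] Matrix ι ι ℂ) (c : ℂ) (ρ : Matrix (ι × A) (ι × A) ℂ) :
    ampl A E (c • ρ) = c • ampl A E ρ := by
  ext x y
  simp [ampl, submatrix_smul]

theorem add_ampl (E F : Matrix ι ι ℂ →ₗ[ℂ] Matrix ι ι ℂ) (ρ : Matrix (ι × A) (ι × A) ℂ) :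
    ampl A (E + F) ρ = ampl A E ρ + ampl A F ρ := rfl

theorem smul_ampl (E : Matrix ι ι ℂ →ₗ[ℂ] Matrix ι ι ℂ) (c : ℂ) (ρ : Matrix (ι × A) (ι × A) ℂ) :
    ampl A (c • E) ρ = c • ampl A E ρ := rfl

theorem comp_ampl (E F : Matrix ι ι ℂ →ₗ[ℂ] Matrix ι ι ℂ) (ρ : Matrix (ι × A) (ι × A) ℂ) :
    ampl A (E ∘ₗ F) ρ = ampl A E (ampl A F ρ) := rfl

section Trace

variable [Fintype A]

/-- The partial trace over the auxiliary space. -/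
def partialTrace (ρ : Matrix (ι × A) (ι × A) ℂ) : Matrix ι ι ℂ :=
  ∑ a, ρ.submatrix (fun i => (i, a)) (fun i => (i, a))

theorem posSemidef_partialTrace {ρ : Matrix (ι × A) (ι × A) ℂ} (hρ : ρ.PosSemidef) :
    (partialTrace ρ).PosSemidef :=
  posSemidef_sum _ fun _ _ => hρ.submatrix _

theorem partialTrace_ampl (E : Matrix ι ι ℂ →ₗ[ℂ] Matrix ι ι ℂ)
    (ρ : Matrix (ι × A) (ι × A) ℂ) : partialTrace (ampl A E ρ) = E (partialTrace ρ) := by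
  rw [partialTrace, partialTrace, map_sum]
  rfl

end Trace

variable [Fintype ι]

section Conj

variable [DecidableEq ι]

theorem conj_apply (K ρ : Matrix ι ι ℂ) : conj K ρ = K * ρ * Kᴴ := by
  simp [conj, Matrix.mul_assoc]

theorem PosSemidef.conj {ρ : Matrix ι ι ℂ} (hρ : ρ.PosSemidef) (K : Matrix ι ι ℂ) :
    (conj K ρ).PosSemidef := by
  rw [conj_apply]
  exact hρ.mul_mul_conjTranspose_same K

theorem trace_conj (K ρ : Matrix ι ι ℂ) : (conj K ρ).trace = (Kᴴ * K * ρ).trace := by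
  rw [conj_apply, trace_mul_comm, Matrix.mul_assoc]

theorem ampl_conj [Fintype A] [DecidableEq A] (K : Matrix ι ι ℂ) (ρ : Matrix (ι × A) (ι × A) ℂ) :
    ampl A (conj K) ρ = (K ⊗ₖ (1 : Matrix A A ℂ)) * ρ * (K ⊗ₖ (1 : Matrix A A ℂ))ᴴ := by
  ext ⟨x, a⟩ ⟨y, b⟩
  simp [ampl, conj_apply, mul_apply, Fintype.sum_prod_type, kroneckerMap_apply, one_apply,
    apply_ite, Finset.sum_ite_eq]

theorem posSemidef_ampl_conj (K : Matrix ι ι ℂ) [Fintype A] {ρ : Matrix (ι × A) (ι × A) ℂ}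
    (hρ : ρ.PosSemidef) : (ampl A (conj K) ρ).PosSemidef := by
  classical
  rw [ampl_conj]
  exact hρ.mul_mul_conjTranspose_same _

end Conj

variable [Fintype A]

theorem trace_partialTrace (ρ : Matrix (ι × A) (ι × A) ℂ) :
    (partialTrace ρ).trace = ρ.trace := by
  simp [partialTrace, trace, Matrix.sum_apply, Fintype.sum_prod_type]

theorem trace_ampl (E : Matrix ι ι ℂ →ₗ[ℂ] Matrix ι ι ℂ) (ρ : Matrix (ι × A) (ι × A) ℂ) :
    (ampl A E ρ).trace = (E (partialTrace ρ)).trace := by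
  rw [← partialTrace_ampl, trace_partialTrace]

/-- `E` is the linear map underlying a `Superoperator`. -/
structure IsSuperop (E : Matrix ι ι ℂ →ₗ[ℂ] Matrix ι ι ℂ) : Prop where
  completely_positive : ∀ (A : Type) [Fintype A] (ρ : Matrix (ι × A) (ι × A) ℂ),
    ρ.PosSemidef → (ampl A E ρ).PosSemidef
  trace_le : ∀ ρ : Matrix ι ι ℂ, ρ.PosSemidef → (E ρ).trace.re ≤ ρ.trace.re

theorem Superoperator.isSuperop (Φ : Superoperator ι) : IsSuperop Φ.map :=
  ⟨Φ.completely_positive, Φ.trace_le⟩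

namespace IsSuperop

variable {E F : Matrix ι ι ℂ →ₗ[ℂ] Matrix ι ι ℂ}

theorem posSemidef (hE : IsSuperop E) {ρ : Matrix ι ι ℂ} (hρ : ρ.PosSemidef) :
    (E ρ).PosSemidef := by
  exact (hE.completely_positive Unit (ρ.submatrix Prod.fst Prod.fst) (hρ.submatrix _)).submatrix
    fun i => (i, ())

theorem trace_ampl_le (hE : IsSuperop E) {ρ : Matrix (ι × A) (ι × A) ℂ} (hρ : ρ.PosSemidef) :
    (ampl A E ρ).trace.re ≤ ρ.trace.re := by
  rw [trace_ampl, ← trace_partialTrace ρ]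
  exact hE.trace_le _ (posSemidef_partialTrace hρ)

theorem comp (hE : IsSuperop E) (hF : IsSuperop F) : IsSuperop (E ∘ₗ F) where
  completely_positive A _ ρ hρ :=
    hE.completely_positive A _ (hF.completely_positive A ρ hρ)
  trace_le ρ hρ := (hE.trace_le _ (hF.posSemidef hρ)).trans (hF.trace_le ρ hρ)

theorem convex (hE : IsSuperop E) (hF : IsSuperop F) (p : unitInterval) :
    IsSuperop (((1 - (p : ℝ) : ℝ) : ℂ) • E + ((p : ℝ) : ℂ) • F) where
  completely_positive A _ ρ hρ := by
    rw [add_ampl, smul_ampl, smul_ampl]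
    refine ((hE.completely_positive A ρ hρ).smul ?_).add ((hF.completely_positive A ρ hρ).smul ?_)
    · exact_mod_cast sub_nonneg.2 p.2.2
    · exact_mod_cast p.2.1
  trace_le ρ hρ := by
    have h1 := hE.trace_le ρ hρ
    have h2 := hF.trace_le ρ hρ
    simp only [LinearMap.add_apply, LinearMap.smul_apply, trace_add, trace_smul, smul_eq_mul,
      Complex.add_re, Complex.re_ofReal_mul]
    nlinarith [p.2.1, sub_nonneg.2 p.2.2]

theorem traceBound_ampl (hE : IsSuperop E) {X : Matrix (ι × A) (ι × A) ℂ} {c : ℝ}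
    (hX : TraceBound X c) : TraceBound (ampl A E X) c := by
  obtain ⟨P, N, hP, hN, rfl, hc⟩ := hX
  refine ⟨ampl A E P, ampl A E N, hE.completely_positive A P hP, hE.completely_positive A N hN,
    ampl_sub E P N, ?_⟩
  have h1 := hE.trace_ampl_le hP
  have h2 := hE.trace_ampl_le hN
  linarith

end IsSuperop

theorem isSuperop_sum_conj [DecidableEq ι] {m : ℕ} (K : Fin m → Matrix ι ι ℂ)
    (hK : ∑ i, (K i)ᴴ * K i = 1) : IsSuperop (∑ i, conj (K i)) where
  completely_positive A _ ρ hρ := by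
    have : ampl A (∑ i, conj (K i)) ρ = ∑ i, ampl A (conj (K i)) ρ := by
      ext x y
      simp [ampl, Matrix.sum_apply]
    rw [this]
    exact posSemidef_sum _ fun i _ => posSemidef_ampl_conj (K i) hρ
  trace_le ρ _ := by
    simp only [LinearMap.sum_apply, trace_sum, trace_conj]
    rw [← trace_sum, ← Matrix.sum_mul, hK, Matrix.one_mul]

theorem isSuperop_conj [DecidableEq ι] {K : Matrix ι ι ℂ} (hK : Kᴴ * K = 1) :
    IsSuperop (conj K) := by
  simpa using isSuperop_sum_conj (fun _ : Fin 1 => K) (by simpa using hK)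

end Ampl

/-! ### Distances of superoperators -/

section Distance

variable {ι : Type} [Fintype ι]

/-- For every auxiliary space and every positive `ρ`, the outputs of `E` and `F` on `ρ` differ by
at most `d * tr ρ` in trace norm. For the diamond distance this says that it is at most `d / 2`,
but the condition composes without passing through suprema. -/
def DistLE (E F : Matrix ι ι ℂ →ₗ[ℂ] Matrix ι ι ℂ) (d : ℝ) : Prop :=
  ∀ (A : Type) [Fintype A] (ρ : Matrix (ι × A) (ι × A) ℂ), ρ.PosSemidef →
    TraceBound (ampl A E ρ - ampl A F ρ) (d * ρ.trace.re)

variable {E E' F F' : Matrix ι ι ℂ →ₗ[ℂ] Matrix ι ι ℂ} {d e : ℝ}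

theorem DistLE.refl (E : Matrix ι ι ℂ →ₗ[ℂ] Matrix ι ι ℂ) : DistLE E E 0 := by
  intro A _ ρ _
  simpa using TraceBound.zero

/-- Errors add up along a composition. -/
theorem DistLE.comp (h : DistLE E' E e) (h' : DistLE F' F d) (he : 0 ≤ e) (hE' : IsSuperop E')
    (hF : IsSuperop F) : DistLE (E' ∘ₗ F') (E ∘ₗ F) (d + e) := by
  intro A _ ρ hρ
  have h1 := hE'.traceBound_ampl (h' A ρ hρ)
  have h2 := (h A _ (hF.completely_positive A ρ hρ)).mono
    (mul_le_mul_of_nonneg_left (hF.trace_ampl_le hρ) he)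
  rw [ampl_sub] at h1
  simpa [comp_ampl, add_mul] using h1.add h2

/-- Mixing `E` with `F` with weight `p` moves it by `p` times the distance of `E` and `F`. -/
theorem DistLE.convex (h : DistLE F E d) (p : unitInterval) :
    DistLE (((1 - (p : ℝ) : ℝ) : ℂ) • E + ((p : ℝ) : ℂ) • F) E (p * d) := by
  intro A _ ρ hρ
  have h1 := (h A ρ hρ).smul p.2.1
  rw [← mul_assoc] at h1
  convert h1 using 1
  rw [add_ampl, smul_ampl, smul_ampl]
  push_cast
  module

variable [DecidableEq ι]

theorem diamondDist_le_one (hE : IsSuperop E) (hF : IsSuperop F) : diamondDist E F ≤ 1 := by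
  simp only [diamondDist, iSup_le_iff]
  rintro A _ _ ρ ⟨hρ, htr⟩
  rw [← ENNReal.ofReal_one]
  refine ENNReal.ofReal_le_ofReal ?_
  have h := TraceBound.traceNorm_le ⟨_, _, hE.completely_positive A ρ hρ,
    hF.completely_positive A ρ hρ, rfl, le_rfl⟩
  have h1 := hE.trace_ampl_le hρ
  have h2 := hF.trace_ampl_le hρ
  rw [htr, Complex.one_re] at h1 h2
  rw [traceDist]
  linarith

/-- The factor `2` is there because the trace distance is half the trace norm. -/
theorem distLE_diamondDist (hE : IsSuperop E) (hF : IsSuperop F) :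
    DistLE E F (2 * (diamondDist E F).toReal) := by
  classical
  intro A _ ρ hρ
  -- the distance is finite, so that `toReal` loses nothing
  have hfin : diamondDist E F ≠ ⊤ := ((diamondDist_le_one hE hF).trans_lt ENNReal.one_lt_top).ne
  rcases (trace_re_nonneg hρ).eq_or_lt with h0 | hpos
  · rw [eq_zero_of_trace_re_eq_zero hρ h0.symm]
    have h0 (G : Matrix ι ι ℂ →ₗ[ℂ] Matrix ι ι ℂ) :
        ampl A G (0 : Matrix (ι × A) (ι × A) ℂ) = 0 := by
      simpa using ampl_smul G 0 (0 : Matrix (ι × A) (ι × A) ℂ)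
    simpa [h0] using TraceBound.zero
  -- normalize `ρ` to a density operator
  set t := ρ.trace.re with ht
  have htC : (t : ℂ) ≠ 0 := by exact_mod_cast hpos.ne'
  set σ := ((t⁻¹ : ℝ) : ℂ) • ρ with hσ
  have hσp : σ.PosSemidef := hρ.smul (by exact_mod_cast inv_nonneg.2 hpos.le)
  have hσt : σ.trace = 1 := by
    rw [hσ, trace_smul, ← ofReal_trace_re hρ, ← ht, smul_eq_mul]
    push_cast
    exact inv_mul_cancel₀ htC
  have hle : ENNReal.ofReal (traceDist (ampl A E σ) (ampl A F σ)) ≤ diamondDist E F := by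
    unfold diamondDist
    exact le_iSup_of_le A <| le_iSup_of_le _ <| le_iSup_of_le _ <| le_iSup_of_le σ <|
      le_iSup_of_le ⟨hσp, hσt⟩ le_rfl
  have hle' := (ENNReal.ofReal_le_iff_le_toReal hfin).1 hle
  have hb : TraceBound (ampl A E σ - ampl A F σ) (2 * (diamondDist E F).toReal) := by
    refine (traceBound_traceNorm ?_).mono (by rw [traceDist] at hle'; linarith)
    exact (hE.completely_positive A σ hσp).1.sub (hF.completely_positive A σ hσp).1
  have hρσ : ρ = (t : ℂ) • σ := by
    rw [hσ, smul_smul]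
    push_cast
    rw [mul_inv_cancel₀ htC, one_smul]
  clear_value σ
  rw [hρσ, ampl_smul E, ampl_smul F, ← smul_sub, mul_comm]
  exact hb.smul hpos.le

end Distance

/-! ### Operators and superoperators on a register -/

section Lift

variable {n k : ℕ} (r : Fin k ↪ Fin n)

/-- The labels of the computational basis of the variables outside the register `r`. -/
abbrev Rest : Type := {v // v ∉ Set.range r} → Fin 2

open Classical in
/-- A basis label of all variables is one of the register together with one of the rest. -/
noncomputable def splitEquiv : Qubits n ≃ Qubits k × Rest r where
  toFun s := (fun i => s (r i), fun v => s v)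
  invFun x := Function.extend r x.1 fun v => if h : v ∉ Set.range r then x.2 ⟨v, h⟩ else 0
  left_inv s := by
    ext1 v
    by_cases h : v ∈ Set.range r
    · obtain ⟨i, rfl⟩ := h
      simp [r.injective.extend_apply]
    · dsimp only
      rw [Function.extend_apply' _ _ _ h, dif_pos h]
  right_inv x := by
    ext1
    · ext1 i
      simp [r.injective.extend_apply]
    · ext1 v
      dsimp only
      rw [Function.extend_apply' _ _ _ v.2, dif_pos v.2]

theorem splitEquiv_symm_eq_extend (a : Qubits k) (s : Qubits n) :
    (splitEquiv r).symm (a, (splitEquiv r s).2) = Function.extend r a s := by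
  ext1 v
  by_cases h : v ∈ Set.range r
  · obtain ⟨i, rfl⟩ := h
    simp [splitEquiv, r.injective.extend_apply]
  · simp only [splitEquiv, Equiv.coe_fn_symm_mk, Equiv.coe_fn_mk]
    rw [Function.extend_apply' _ _ _ h, Function.extend_apply' _ _ _ h, dif_pos h]

open Classical in
theorem liftOp_eq (A : Op k) :
    liftOp r A =
      (A ⊗ₖ (1 : Matrix (Rest r) (Rest r) ℂ)).submatrix (splitEquiv r) (splitEquiv r) := by
  ext s t
  have h : (∀ v, v ∉ Set.range r → s v = t v) ↔ (splitEquiv r s).2 = (splitEquiv r t).2 := by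
    simp only [splitEquiv, Equiv.coe_fn_mk, funext_iff, Subtype.forall]
  simp only [liftOp, of_apply, h, submatrix_apply, kroneckerMap_apply, one_apply, mul_ite, mul_one,
    mul_zero]
  rfl

theorem liftOp_mul (A B : Op k) : liftOp r (A * B) = liftOp r A * liftOp r B := by
  classical
  rw [liftOp_eq, liftOp_eq, liftOp_eq, submatrix_mul_equiv, ← mul_kronecker_mul, Matrix.one_mul]

theorem liftOp_conjTranspose (A : Op k) : liftOp r Aᴴ = (liftOp r A)ᴴ := by
  classical
  rw [liftOp_eq, liftOp_eq, conjTranspose_submatrix, conjTranspose_kronecker, conjTranspose_one]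

theorem liftOp_one : liftOp r (1 : Op k) = 1 := by
  classical
  rw [liftOp_eq, one_kronecker_one, submatrix_one_equiv]

theorem liftOp_add (A B : Op k) : liftOp r (A + B) = liftOp r A + liftOp r B := by
  classical
  rw [liftOp_eq, liftOp_eq, liftOp_eq, add_kronecker]
  rfl

theorem liftSuper_eq (E : Op k →ₗ[ℂ] Op k) (ρ : Op n) :
    liftSuper r E ρ =
      (ampl (Rest r) E (ρ.submatrix (splitEquiv r).symm (splitEquiv r).symm)).submatrix
        (splitEquiv r) (splitEquiv r) := by
  ext s t
  simp only [ampl, liftSuper, LinearMap.coe_mk, AddHom.coe_mk, of_apply, submatrix_apply,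
    submatrix_submatrix, Function.comp_def, splitEquiv_symm_eq_extend]
  rfl

theorem conj_liftOp (U : Op k) : conj (liftOp r U) = liftSuper r (conj U) := by
  classical
  ext1 ρ
  rw [liftSuper_eq, ampl_conj, conj_apply, liftOp_eq, conjTranspose_submatrix,
    ← submatrix_mul_equiv _ _ _ (splitEquiv r) _, ← submatrix_mul_equiv _ _ _ (splitEquiv r) _]
  simp

/-- Acting on a register of `H ⊗ A` is acting on the first factor of a splitting whose second factor
collects `A` and the rest of the variables. -/
theorem ampl_liftSuper (A : Type) :
    ∃ e : Qubits n × A ≃ Qubits k × (Rest r × A), ∀ (E : Op k →ₗ[ℂ] Op k)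
      (ρ : Matrix (Qubits n × A) (Qubits n × A) ℂ), ampl A (liftSuper r E) ρ =
        (ampl (Rest r × A) E (ρ.submatrix e.symm e.symm)).submatrix e e := by
  refine ⟨((splitEquiv r).prodCongr (Equiv.refl A)).trans (Equiv.prodAssoc _ _ _), fun E ρ => ?_⟩
  ext ⟨s, a⟩ ⟨t, b⟩
  simp only [ampl, of_apply, liftSuper_eq, submatrix_apply]
  rfl

end Lift

section LiftSuper

variable {n k : ℕ} (r : Fin k ↪ Fin n) {E F : Op k →ₗ[ℂ] Op k} {d : ℝ}

theorem IsSuperop.liftSuper (hE : IsSuperop E) : IsSuperop (liftSuper r E) where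
  completely_positive A _ ρ hρ := by
    classical
    obtain ⟨e, he⟩ := ampl_liftSuper r A
    rw [he]
    exact (hE.completely_positive _ _ (hρ.submatrix _)).submatrix _
  trace_le ρ hρ := by
    classical
    rw [liftSuper_eq, trace_submatrix_equiv]
    refine (hE.trace_ampl_le (hρ.submatrix _)).trans ?_
    rw [trace_submatrix_equiv]

theorem DistLE.liftSuper (h : DistLE E F d) :
    DistLE (liftSuper r E) (QWhile.liftSuper r F) d := by
  classical
  intro A _ ρ hρ
  obtain ⟨e, he⟩ := ampl_liftSuper r A
  have h1 := (h _ _ (hρ.submatrix e.symm)).submatrix e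
  rw [trace_submatrix_equiv] at h1
  rwa [he, he]

end LiftSuper

/-! ### Semantics of loops -/

section Loop

variable {ι : Type}

theorem tendsto_ampl {A : Type} {E : ℕ → (Matrix ι ι ℂ →ₗ[ℂ] Matrix ι ι ℂ)}
    {L : Matrix ι ι ℂ →ₗ[ℂ] Matrix ι ι ℂ} (h : ∀ ρ, Tendsto (fun k => E k ρ) atTop (𝓝 (L ρ)))
    (ρ : Matrix (ι × A) (ι × A) ℂ) :
    Tendsto (fun k => ampl A (E k) ρ) atTop (𝓝 (ampl A L ρ)) :=
  tendsto_pi_nhds.2 fun x => tendsto_pi_nhds.2 fun y =>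
    tendsto_pi_nhds.1 (tendsto_pi_nhds.1 (h _) x.1) y.1

variable [Fintype ι]

theorem isLUB_of_tendsto_of_monotone {f : ℕ → Matrix ι ι ℂ} {B : Matrix ι ι ℂ} (hf : Monotone f)
    (h : Tendsto f atTop (𝓝 B)) : IsLUB (Set.range f) B := by
  refine ⟨?_, fun C hC => ?_⟩
  · rintro _ ⟨k, rfl⟩
    exact isClosed_posSemidef.mem_of_tendsto (h.sub_const (f k))
      ((eventually_ge_atTop k).mono fun j hj => hf hj)
  · exact isClosed_posSemidef.mem_of_tendsto (h.const_sub C)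
      (Eventually.of_forall fun k => hC ⟨k, rfl⟩)

theorem isSuperop_zero : IsSuperop (0 : Matrix ι ι ℂ →ₗ[ℂ] Matrix ι ι ℂ) where
  completely_positive _ _ _ _ := by
    convert PosSemidef.zero
    ext
    simp [ampl]
  trace_le ρ hρ := by simpa using trace_re_nonneg hρ

variable [DecidableEq ι]

variable {M₀ M₁ : Matrix ι ι ℂ} {E E' : Matrix ι ι ℂ →ₗ[ℂ] Matrix ι ι ℂ}

/-- Measuring with `{M₀, M₁}` and continuing with `E` on outcome `1`. -/
theorem isSuperop_conj_add_comp (hM : M₀ᴴ * M₀ + M₁ᴴ * M₁ = 1) (hE : IsSuperop E) :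
    IsSuperop (conj M₀ + E ∘ₗ conj M₁) where
  completely_positive A _ ρ hρ := (posSemidef_ampl_conj M₀ hρ).add
    (hE.completely_positive A _ (posSemidef_ampl_conj M₁ hρ))
  trace_le ρ hρ := by
    have h := hE.trace_le _ (PosSemidef.conj hρ M₁)
    have h1 : (conj M₀ ρ).trace + (conj M₁ ρ).trace = ρ.trace := by
      rw [trace_conj, trace_conj, ← trace_add, ← Matrix.add_mul, hM, Matrix.one_mul]
    rw [← h1]
    simpa using h

theorem isSuperop_whileApprox (hM : M₀ᴴ * M₀ + M₁ᴴ * M₁ = 1) (hE : IsSuperop E) (k : ℕ) :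
    IsSuperop (whileApprox M₀ M₁ E k) := by
  induction k with
  | zero => exact isSuperop_zero
  | succ k ih => exact isSuperop_conj_add_comp hM (ih.comp hE)

theorem posSemidef_whileApprox_succ_sub (hE : IsSuperop E) (k : ℕ) {ρ : Matrix ι ι ℂ}
    (hρ : ρ.PosSemidef) :
    (whileApprox M₀ M₁ E (k + 1) ρ - whileApprox M₀ M₁ E k ρ).PosSemidef := by
  induction k generalizing ρ with
  | zero => simpa [whileApprox] using PosSemidef.conj hρ M₀
  | succ k ih =>
    have h := ih (hE.posSemidef (PosSemidef.conj hρ M₁))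
    rw [whileApprox, whileApprox]
    convert h using 1
    rw [LinearMap.add_apply, LinearMap.add_apply, add_sub_add_left_eq_sub]
    rfl

theorem monotone_whileApprox (hE : IsSuperop E) {ρ : Matrix ι ι ℂ} (hρ : ρ.PosSemidef) :
    Monotone fun k => whileApprox M₀ M₁ E k ρ :=
  monotone_nat_of_le_succ fun k => posSemidef_whileApprox_succ_sub hE k hρ

/-- The increments of the approximations are positive with traces summing to at most `tr ρ`, so
their entries are absolutely summable. -/
theorem exists_tendsto_whileApprox_of_posSemidef (hM : M₀ᴴ * M₀ + M₁ᴴ * M₁ = 1)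
    (hE : IsSuperop E) {ρ : Matrix ι ι ℂ} (hρ : ρ.PosSemidef) :
    ∃ σ, Tendsto (fun k => whileApprox M₀ M₁ E k ρ) atTop (𝓝 σ) := by
  set D : ℕ → Matrix ι ι ℂ :=
    fun k => whileApprox M₀ M₁ E (k + 1) ρ - whileApprox M₀ M₁ E k ρ with hD
  have hDpos (k : ℕ) : (D k).PosSemidef := posSemidef_whileApprox_succ_sub hE k hρ
  have hsum (k : ℕ) : ∑ j ∈ Finset.range k, D j = whileApprox M₀ M₁ E k ρ := by
    rw [Finset.sum_range_sub (fun k => whileApprox M₀ M₁ E k ρ)]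
    simp [whileApprox]
  have htr : Summable fun k => (D k).trace.re := by
    refine summable_of_sum_range_le (c := ρ.trace.re) (fun k => trace_re_nonneg (hDpos k))
      fun k => ?_
    rw [← Complex.re_sum, ← trace_sum, hsum]
    exact (isSuperop_whileApprox hM hE k).trace_le ρ hρ
  have hentry (i j : ι) : Summable fun k => D k i j :=
    Summable.of_norm_bounded htr fun k => norm_apply_le_trace_re (hDpos k) i j
  refine ⟨fun i j => ∑' k, D k i j, ?_⟩
  refine tendsto_pi_nhds.2 fun i => tendsto_pi_nhds.2 fun j => ?_
  simpa only [← Matrix.sum_apply, hsum] using (hentry i j).hasSum.tendsto_sum_nat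

theorem span_posSemidef : Submodule.span ℂ {ρ : Matrix ι ι ℂ | ρ.PosSemidef} = ⊤ := by
  have h : {ρ : Matrix ι ι ℂ | ρ.PosSemidef} = {ρ | 0 ≤ ρ} := by
    ext ρ
    exact nonneg_iff_posSemidef.symm
  rw [h]
  -- the operator norm makes matrices a C⋆-algebra, with the Löwner order as its order
  open scoped Matrix.Norms.L2Operator in exact CStarAlgebra.span_nonneg (A := Matrix ι ι ℂ)

theorem exists_tendsto_whileApprox (hM : M₀ᴴ * M₀ + M₁ᴴ * M₁ = 1) (hE : IsSuperop E)
    (ρ : Matrix ι ι ℂ) : ∃ σ, Tendsto (fun k => whileApprox M₀ M₁ E k ρ) atTop (𝓝 σ) := by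
  have hρ : ρ ∈ Submodule.span ℂ {ρ : Matrix ι ι ℂ | ρ.PosSemidef} :=
    span_posSemidef (ι := ι) ▸ Submodule.mem_top
  induction hρ using Submodule.span_induction with
  | mem ρ h => exact exists_tendsto_whileApprox_of_posSemidef hM hE h
  | zero => exact ⟨0, by simp only [map_zero, tendsto_const_nhds]⟩
  | add ρ σ _ _ h h' =>
    obtain ⟨τ, h⟩ := h
    obtain ⟨τ', h'⟩ := h'
    exact ⟨τ + τ', by simpa using h.add h'⟩
  | smul c ρ _ h =>
    obtain ⟨τ, h⟩ := h
    exact ⟨c • τ, by simpa using h.const_smul c⟩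

/-- The least upper bounds defining the meaning of a loop exist and are limits of the
approximations. -/
theorem tendsto_whileApprox (hM : M₀ᴴ * M₀ + M₁ᴴ * M₁ = 1) (hE : IsSuperop E)
    (ρ : Matrix ι ι ℂ) :
    Tendsto (fun k => whileApprox M₀ M₁ E k ρ) atTop (𝓝 (whileSem M₀ M₁ E ρ)) := by
  choose f hf using exists_tendsto_whileApprox (M₀ := M₀) (M₁ := M₁) hM hE
  let L : Matrix ι ι ℂ →ₗ[ℂ] Matrix ι ι ℂ :=
    linearMapOfTendsto f (whileApprox M₀ M₁ E) (tendsto_pi_nhds.2 hf)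
  have hLUB {ρ : Matrix ι ι ℂ} (hρ : ρ.PosSemidef) :
      IsLUB (Set.range fun k => whileApprox M₀ M₁ E k ρ) (L ρ) :=
    isLUB_of_tendsto_of_monotone (monotone_whileApprox hE hρ) (hf ρ)
  have hex : ∃ L, IsWhileSem M₀ M₁ E L := ⟨L, fun ρ hρ _ => hLUB hρ⟩
  have hsem : IsWhileSem M₀ M₁ E (whileSem M₀ M₁ E) := by
    rw [whileSem, dif_pos hex]
    exact hex.choose_spec
  -- both maps are least upper bounds on partial density operators, and these span
  have hL : whileSem M₀ M₁ E = L := by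
    refine LinearMap.ext_on span_posSemidef fun ρ hρ => ?_
    have ht : (0 : ℝ) < 1 + ρ.trace.re := by linarith [trace_re_nonneg hρ]
    set c : ℂ := (((1 + ρ.trace.re)⁻¹ : ℝ) : ℂ) with hc
    have hc0 : c ≠ 0 := by
      rw [hc]
      exact_mod_cast (inv_pos.2 ht).ne'
    have hcρ : (c • ρ).PosSemidef :=
      PosSemidef.smul hρ (by rw [hc]; exact_mod_cast (inv_pos.2 ht).le)
    have hle : (c • ρ).trace.re ≤ 1 := by
      rw [trace_smul, smul_eq_mul, hc, Complex.re_ofReal_mul, inv_mul_le_one₀ ht]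
      linarith
    have h := (hsem _ hcρ hle).unique (hLUB hcρ)
    rw [map_smul, map_smul] at h
    exact smul_right_injective _ hc0 h
  rw [hL]
  exact hf ρ

/-- Robustness of loops, for the approximations. Writing `W'ₖ`, `Wₖ` for the approximations with
bodies `E'`, `E`, one has `W'ₖ₊₁ - Wₖ₊₁ = W'ₖ (E' - E) M₁ + (W'ₖ - Wₖ) E M₁`. The first
term costs `d` times the weight of the guard, and the body `E` shrinks that weight by the
factor `a`. -/
theorem traceBound_whileApprox_sub {a d : ℝ} (hM : M₀ᴴ * M₀ + M₁ᴴ * M₁ = 1) (hE : IsSuperop E)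
    (hE' : IsSuperop E') (ha : a < 1) (hd : 0 ≤ d) (h : DistLE E' E d)
    (hbdd : ∀ ρ : Matrix ι ι ℂ, ρ.PosSemidef →
      (M₁ᴴ * M₁ * loopStep M₁ E ρ).trace.re ≤ a * (M₁ᴴ * M₁ * ρ).trace.re)
    (k : ℕ) {A : Type} [Fintype A] {ρ : Matrix (ι × A) (ι × A) ℂ} (hρ : ρ.PosSemidef) :
    TraceBound (ampl A (whileApprox M₀ M₁ E' k) ρ - ampl A (whileApprox M₀ M₁ E k) ρ)
      (d / (1 - a) * (M₁ᴴ * M₁ * partialTrace ρ).trace.re) := by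
  have ha' : 0 < 1 - a := sub_pos.2 ha
  have hw (σ : Matrix ι ι ℂ) (hσ : σ.PosSemidef) : 0 ≤ (M₁ᴴ * M₁ * σ).trace.re := by
    rw [← trace_conj]
    exact trace_re_nonneg (PosSemidef.conj hσ M₁)
  induction k generalizing ρ with
  | zero =>
    have h0 : ampl A (0 : Matrix ι ι ℂ →ₗ[ℂ] Matrix ι ι ℂ) ρ = 0 := rfl
    simp only [whileApprox, h0, sub_zero]
    exact TraceBound.zero.mono
      (mul_nonneg (div_nonneg hd ha'.le) (hw _ (posSemidef_partialTrace hρ)))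
  | succ k ih =>
    set τ := ampl A (conj M₁) ρ with hτ
    have hτp : τ.PosSemidef := posSemidef_ampl_conj M₁ hρ
    have h1 := (isSuperop_whileApprox hM hE' k).traceBound_ampl (h A τ hτp)
    have h2 := ih (hE.completely_positive A τ hτp)
    have e1 : τ.trace = (M₁ᴴ * M₁ * partialTrace ρ).trace := by rw [trace_ampl, trace_conj]
    have e2 : partialTrace (ampl A E τ) = loopStep M₁ E (partialTrace ρ) := by
      rw [partialTrace_ampl, partialTrace_ampl]
      rfl
    rw [e1, ampl_sub] at h1
    rw [e2] at h2
    have h3 := hbdd _ (posSemidef_partialTrace hρ)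
    refine TraceBound.mono (c := d * (M₁ᴴ * M₁ * partialTrace ρ).trace.re +
      d / (1 - a) * (M₁ᴴ * M₁ * loopStep M₁ E (partialTrace ρ)).trace.re) ?_ ?_
    · convert h1.add h2 using 1
      simp only [whileApprox, add_ampl, loopStep, comp_ampl, ← hτ]
      abel
    · have h4 := mul_le_mul_of_nonneg_left h3 (div_nonneg hd ha'.le)
      have h5 : d + d / (1 - a) * a = d / (1 - a) := by
        field_simp
        ring
      linear_combination h4 + (M₁ᴴ * M₁ * partialTrace ρ).trace.re * h5

/-- The meanings of two loops with the same measurement, one of which shrinks the weight of the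
guard by the factor `a` in each round. -/
theorem traceNorm_ampl_whileSem_sub_le {a d : ℝ} (hM : M₀ᴴ * M₀ + M₁ᴴ * M₁ = 1)
    (hE : IsSuperop E) (hE' : IsSuperop E') (ha : a < 1) (hd : 0 ≤ d) (h : DistLE E' E d)
    (hbdd : ∀ ρ : Matrix ι ι ℂ, ρ.PosSemidef →
      (M₁ᴴ * M₁ * loopStep M₁ E ρ).trace.re ≤ a * (M₁ᴴ * M₁ * ρ).trace.re)
    {A : Type} [Fintype A] [DecidableEq A] {ρ : Matrix (ι × A) (ι × A) ℂ} (hρ : ρ.PosSemidef) :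
    traceNorm (ampl A (whileSem M₀ M₁ E') ρ - ampl A (whileSem M₀ M₁ E) ρ) ≤
      d / (1 - a) * ρ.trace.re := by
  refine traceNorm_le_of_tendsto (fun k =>
    (traceBound_whileApprox_sub hM hE hE' ha hd h hbdd k hρ).mono ?_)
    ((tendsto_ampl (tendsto_whileApprox hM hE') ρ).sub
      (tendsto_ampl (tendsto_whileApprox hM hE) ρ))
  refine mul_le_mul_of_nonneg_left ?_ (div_nonneg hd (sub_pos.2 ha).le)
  rw [← trace_partialTrace, ← trace_conj]
  have hp := posSemidef_partialTrace hρ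
  have h1 : (conj M₀ (partialTrace ρ)).trace + (conj M₁ (partialTrace ρ)).trace =
      (partialTrace ρ).trace := by
    rw [trace_conj, trace_conj, ← trace_add, ← Matrix.add_mul, hM, Matrix.one_mul]
  rw [← h1, Complex.add_re]
  linarith [trace_re_nonneg (PosSemidef.conj hp M₀)]

end Loop

/-! ### Semantics of the elementary statements -/

section Statements

variable {n k : ℕ}

theorem isSuperop_conj_unitary (r : Fin k ↪ Fin n) (U : Unitary k) :
    IsSuperop (conj (liftOp r (U : Op k))) := by
  refine isSuperop_conj ?_
  rw [← liftOp_conjTranspose, ← liftOp_mul, ← star_eq_conjTranspose,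
    mem_unitaryGroup_iff'.1 U.2, liftOp_one]

theorem isSuperop_initSem (q : Fin n) : IsSuperop (initSem q) := by
  refine isSuperop_sum_conj _ ?_
  have h (x : Fin 2) : (qubitOp (single 0 x 1))ᴴ * qubitOp (single 0 x 1) =
      (proj x)ᴴ * proj x := by
    ext s t
    simp only [mul_apply, conjTranspose_apply, proj, qubitOp, of_apply]
    rw [← (Equiv.funUnique (Fin 1) (Fin 2)).symm.sum_comp,
      ← (Equiv.funUnique (Fin 1) (Fin 2)).symm.sum_comp]
    fin_cases x <;> simp [single_apply]
  simp only [← liftOp_conjTranspose, ← liftOp_mul, h]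
  rw [Fin.sum_univ_two, ← liftOp_add, proj_complete, liftOp_one]

theorem isSuperop_noisyGate (r : Fin k ↪ Fin n) (U : Unitary k) (p : unitInterval)
    (Φ : Superoperator (Qubits k)) : IsSuperop (NoisyProg.unitary r U p Φ).sem :=
  (isSuperop_conj_unitary r U).convex (Φ.isSuperop.liftSuper r) p

theorem isSuperop_conj_unitary_self (U : Unitary k) : IsSuperop (conj (U : Op k)) :=
  isSuperop_conj (mem_unitaryGroup_iff'.1 U.2)

theorem gateError_nonneg (U : Unitary k) (p : unitInterval) (Φ : Superoperator (Qubits k)) :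
    0 ≤ gateError U p Φ :=
  mul_nonneg p.2.1 ENNReal.toReal_nonneg

theorem distLE_noisyGate (r : Fin k ↪ Fin n) (U : Unitary k) (p : unitInterval)
    (Φ : Superoperator (Qubits k)) :
    DistLE (NoisyProg.unitary r U p Φ).sem (conj (liftOp r (U : Op k)))
      (2 * gateError U p Φ) := by
  have h := (distLE_diamondDist Φ.isSuperop (isSuperop_conj_unitary_self U)).liftSuper r
  rw [← conj_liftOp] at h
  have e : 2 * gateError U p Φ = p * (2 * (diamondDist Φ.map (conj (U : Op k))).toReal) := by
    simp only [gateError]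
    ring
  rw [e]
  exact h.convex p

end Statements

/-! ### The loop of the Bernoulli factory -/

section BernoulliFactory

variable (p pV pU : unitInterval) (ΦV : Superoperator (Qubits 1)) (ΦU : Superoperator (Qubits 2))

theorem sum_qubits_two (f : Qubits 2 → ℂ) :
    ∑ s, f s = f ![0, 0] + f ![0, 1] + (f ![1, 0] + f ![1, 1]) := by
  rw [← (finTwoArrowEquiv (Fin 2)).symm.sum_comp, Fintype.sum_prod_type]
  simp

theorem liftOp_qubit_zero (A : Matrix (Fin 2) (Fin 2) ℂ) (s t : Qubits 2) :
    liftOp (reg₁ 0) (qubitOp A) s t = if s 1 = t 1 then A (s 0) (t 0) else 0 := by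
  simp [liftOp, qubitOp, reg₁, Fin.forall_fin_two]

theorem liftOp_qubit_one (A : Matrix (Fin 2) (Fin 2) ℂ) (s t : Qubits 2) :
    liftOp (reg₁ 1) (qubitOp A) s t = if s 0 = t 0 then A (s 1) (t 1) else 0 := by
  simp [liftOp, qubitOp, reg₁, Fin.forall_fin_two]

theorem liftOp_reg₁₂ (A : Op 2) : liftOp reg₁₂ A = A := by
  ext s t
  simp [liftOp, reg₁₂]

theorem liftOp_zero_mulVec (A : Matrix (Fin 2) (Fin 2) ℂ) (f g : Fin 2 → ℂ) :
    (liftOp (reg₁ 0) (qubitOp A) : Op 2) *ᵥ (fun s => f (s 0) * g (s 1)) =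
      fun s => (A *ᵥ f) (s 0) * g (s 1) := by
  ext s
  simp only [mulVec, dotProduct, liftOp_qubit_zero, sum_qubits_two, Fin.sum_univ_two]
  generalize s 1 = b
  fin_cases b <;> simp <;> ring

theorem liftOp_one_mulVec (A : Matrix (Fin 2) (Fin 2) ℂ) (f g : Fin 2 → ℂ) :
    (liftOp (reg₁ 1) (qubitOp A) : Op 2) *ᵥ (fun s => f (s 0) * g (s 1)) =
      fun s => f (s 0) * (A *ᵥ g) (s 1) := by
  ext s
  simp only [mulVec, dotProduct, liftOp_qubit_one, sum_qubits_two, Fin.sum_univ_two]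
  generalize s 0 = a
  fin_cases a <;> simp <;> ring

/-- The vector `|00⟩`, as a product of two functions. -/
theorem ket_zero_zero :
    ket 0 0 = fun s => (Pi.single 0 1 : Fin 2 → ℂ) (s 0) * (Pi.single 0 1 : Fin 2 → ℂ) (s 1) := by
  ext s
  simp only [ket, Pi.single_apply, funext_iff, Fin.forall_fin_two]
  by_cases h0 : s 0 = 0 <;> by_cases h1 : s 1 = 0 <;> simp [h0, h1]

theorem initSem_zero_apply (X : Op 2) (s t : Qubits 2) :
    initSem 0 X s t = if s 0 = 0 ∧ t 0 = 0 then
      X ![0, s 1] ![0, t 1] + X ![1, s 1] ![1, t 1] else 0 := by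
  simp only [initSem, Fin.sum_univ_two, LinearMap.add_apply, conj_apply, Matrix.add_apply,
    mul_apply, conjTranspose_apply, liftOp_qubit_zero, sum_qubits_two, single_apply]
  generalize s 0 = a, s 1 = b, t 0 = c, t 1 = d
  fin_cases a <;> fin_cases b <;> fin_cases c <;> fin_cases d <;> simp

theorem initSem_one_apply (X : Op 2) (s t : Qubits 2) :
    initSem 1 X s t = if s 1 = 0 ∧ t 1 = 0 then
      X ![s 0, 0] ![t 0, 0] + X ![s 0, 1] ![t 0, 1] else 0 := by
  simp only [initSem, Fin.sum_univ_two, LinearMap.add_apply, conj_apply, Matrix.add_apply,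
    mul_apply, conjTranspose_apply, liftOp_qubit_one, sum_qubits_two, single_apply]
  generalize s 0 = a, s 1 = b, t 0 = c, t 1 = d
  fin_cases a <;> fin_cases b <;> fin_cases c <;> fin_cases d <;> simp

theorem initSem_initSem (X : Op 2) :
    initSem 1 (initSem 0 X) = X.trace • ketbra (ket 0 0) (ket 0 0) := by
  ext s t
  rw [initSem_one_apply, initSem_zero_apply, initSem_zero_apply, ketbra, Matrix.smul_apply,
    vecMulVec_apply, ket_zero_zero, trace, sum_qubits_two]
  simp only [diag, Pi.star_apply, Pi.single_apply]
  by_cases hs0 : s 0 = 0 <;> by_cases hs1 : s 1 = 0 <;> by_cases ht0 : t 0 = 0 <;>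
    by_cases ht1 : t 1 = 0 <;> simp [hs0, hs1, ht0, ht1]
  ring

theorem conj_ketbra (K : Op 2) (c : ℂ) (x : Qubits 2 → ℂ) :
    conj K (c • ketbra x x) = c • ketbra (K *ᵥ x) (K *ᵥ x) := by
  rw [map_smul, conj_apply, ketbra, ketbra, mul_vecMulVec, vecMulVec_mul, star_mulVec]

/-- The qubit state `√p |0⟩ + √(1-p) |1⟩` prepared by `V`. -/
noncomputable def coin : Fin 2 → ℂ := ![(√(p : ℝ) : ℂ), (√(1 - (p : ℝ)) : ℂ)]

theorem ideal_qbfBody_sem (X : Op 2) :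
    (qbfBody p pV pU ΦV ΦU).ideal.sem X =
      X.trace • ketbra (matU *ᵥ fun s => coin p (s 0) * coin p (s 1))
        (matU *ᵥ fun s => coin p (s 0) * coin p (s 1)) := by
  have h : (qbfBody p pV pU ΦV ΦU).ideal.sem X =
      conj (liftOp reg₁₂ matU) (conj (liftOp (reg₁ 1) (gateV p : Op 1))
        (conj (liftOp (reg₁ 0) (gateV p : Op 1)) (initSem 1 (initSem 0 X)))) := rfl
  have hV : !![(√(p : ℝ) : ℂ), -(√(1 - (p : ℝ)) : ℂ); (√(1 - (p : ℝ)) : ℂ), (√(p : ℝ) : ℂ)] *ᵥ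
      (Pi.single 0 1 : Fin 2 → ℂ) = coin p := by
    ext i
    fin_cases i <;> simp [coin]
  rw [h, initSem_initSem, conj_ketbra, conj_ketbra, conj_ketbra, ket_zero_zero, gateV,
    liftOp_zero_mulVec, liftOp_one_mulVec, hV, liftOp_reg₁₂]

theorem conjTranspose_qbfM₁_mul_self :
    qbfM₁ᴴ * qbfM₁ = diagonal fun s => if s 1 = 1 then 1 else 0 := by
  have h : qbfM₁ = diagonal fun s => if s 1 = 1 then 1 else 0 := by
    ext s t
    rw [qbfM₁, proj, liftOp_qubit_one, diagonal_apply, single_apply]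
    obtain ⟨⟨a, b⟩, rfl⟩ := (finTwoArrowEquiv (Fin 2)).symm.surjective s
    obtain ⟨⟨c, d⟩, rfl⟩ := (finTwoArrowEquiv (Fin 2)).symm.surjective t
    fin_cases a <;> fin_cases b <;> fin_cases c <;> fin_cases d <;>
      simp [funext_iff, Fin.forall_fin_two]
  rw [h, diagonal_conjTranspose, diagonal_mul_diagonal]
  congr 1
  ext s
  split_ifs with hs <;> simp [hs]

/-- After one run of the loop body the guard holds with probability `1/2`, whatever the input: the
amplitude of `|01⟩` is `(p + (1 - p)) / √2` and that of `|11⟩` vanishes. -/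
theorem trace_guard_ideal_qbfBody (X : Op 2) :
    (qbfM₁ᴴ * qbfM₁ * (qbfBody p pV pU ΦV ΦU).ideal.sem X).trace = 1 / 2 * X.trace := by
  have h1 : (√(p : ℝ) : ℂ) * (√(p : ℝ) : ℂ) = ((p : ℝ) : ℂ) := by
    rw [← Complex.ofReal_mul, Real.mul_self_sqrt p.2.1]
  have h2 : (√(1 - (p : ℝ)) : ℂ) * (√(1 - (p : ℝ)) : ℂ) = 1 - ((p : ℝ) : ℂ) := by
    rw [← Complex.ofReal_mul, Real.mul_self_sqrt (sub_nonneg.2 p.2.2)]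
    push_cast
    rfl
  have h3 : ((√2 : ℝ) : ℂ)⁻¹ * ((√2 : ℝ) : ℂ)⁻¹ = 1 / 2 := by
    rw [← mul_inv, ← Complex.ofReal_mul, Real.mul_self_sqrt (by norm_num)]
    norm_num
  set b := matU *ᵥ fun s => coin p (s 0) * coin p (s 1) with hb
  have hb01 : b ![0, 1] = ((√2 : ℝ) : ℂ)⁻¹ := by
    simp only [hb, mulVec, dotProduct, sum_qubits_two, matU, ketbra, bellPhi, bellPsi, ket,
      vecMulVec_apply, Matrix.add_apply]
    simp [coin, funext_iff, Fin.forall_fin_two, h1, h2]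
    ring
  have hb11 : b ![1, 1] = 0 := by
    simp only [hb, mulVec, dotProduct, sum_qubits_two, matU, ketbra, bellPhi, bellPsi, ket,
      vecMulVec_apply, Matrix.add_apply]
    simp [coin, funext_iff, Fin.forall_fin_two]
    ring
  rw [ideal_qbfBody_sem, conjTranspose_qbfM₁_mul_self, trace]
  simp only [diag, diagonal_mul, sum_qubits_two, Matrix.smul_apply, ketbra, vecMulVec_apply,
    Pi.star_apply, ← hb, hb01, hb11]
  simp [h3]
  ring

theorem trace_guard_loopStep (X : Op 2) :
    (qbfM₁ᴴ * qbfM₁ * loopStep qbfM₁ (qbfBody p pV pU ΦV ΦU).ideal.sem X).trace =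
      1 / 2 * (qbfM₁ᴴ * qbfM₁ * X).trace := by
  exact (trace_guard_ideal_qbfBody p pV pU ΦV ΦU (conj qbfM₁ X)).trans (by rw [trace_conj])

theorem dual_loopStep_qbf :
    dual (loopStep qbfM₁ (qbfBody p pV pU ΦV ΦU).ideal.sem) (qbfM₁ᴴ * qbfM₁) =
      (1 / 2 : ℂ) • (qbfM₁ᴴ * qbfM₁) := by
  ext i j
  rw [dual, of_apply, trace_guard_loopStep, trace_mul_single]
  simp

theorem isBounded_qbfLoop : (qbfLoop p pV pU ΦV ΦU).ideal.IsBounded (1 / 2) 1 := by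
  refine ⟨by norm_num, by norm_num, le_rfl, le_of_eq ?_⟩
  rw [Function.iterate_one]
  refine (dual_loopStep_qbf p pV pU ΦV ΦU).trans ?_
  push_cast
  rfl

theorem isSuperop_qbfBody : IsSuperop (qbfBody p pV pU ΦV ΦU).sem :=
  ((((isSuperop_noisyGate _ _ _ _).comp (isSuperop_noisyGate _ _ _ _)).comp
    (isSuperop_noisyGate _ _ _ _)).comp (isSuperop_initSem 1)).comp (isSuperop_initSem 0)

theorem isSuperop_ideal_qbfBody : IsSuperop (qbfBody p pV pU ΦV ΦU).ideal.sem :=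
  ((((isSuperop_conj_unitary _ _).comp (isSuperop_conj_unitary _ _)).comp
    (isSuperop_conj_unitary _ _)).comp (isSuperop_initSem 1)).comp (isSuperop_initSem 0)

theorem distLE_qbfBody :
    DistLE (qbfBody p pV pU ΦV ΦU).sem (qbfBody p pV pU ΦV ΦU).ideal.sem
      (2 * (2 * gateError (gateV p) pV ΦV + gateError gateU pU ΦU)) := by
  have hV := gateError_nonneg (gateV p) pV ΦV
  have hU := gateError_nonneg gateU pU ΦU
  have hUV := (distLE_noisyGate reg₁₂ gateU pU ΦU).comp
    (distLE_noisyGate (reg₁ 1) (gateV p) pV ΦV) (by positivity)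
    (isSuperop_noisyGate _ _ _ _) (isSuperop_conj_unitary _ _)
  have hUVs := (isSuperop_noisyGate reg₁₂ gateU pU ΦU).comp
    (isSuperop_noisyGate (reg₁ 1) (gateV p) pV ΦV)
  have hUVV := hUV.comp (distLE_noisyGate (reg₁ 0) (gateV p) pV ΦV) (by positivity) hUVs
    (isSuperop_conj_unitary _ _)
  have hUVVs := hUVs.comp (isSuperop_noisyGate (reg₁ 0) (gateV p) pV ΦV)
  have h1 := hUVV.comp (DistLE.refl (initSem 1)) (by positivity) hUVVs (isSuperop_initSem 1)
  have h0 := h1.comp (DistLE.refl (initSem 0)) (by positivity)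
    (hUVVs.comp (isSuperop_initSem 1)) (isSuperop_initSem 0)
  have e : 2 * (2 * gateError (gateV p) pV ΦV + gateError gateU pU ΦU) =
      0 + (0 + (2 * gateError (gateV p) pV ΦV +
        (2 * gateError (gateV p) pV ΦV + 2 * gateError gateU pU ΦU))) := by ring
  rw [e]
  exact h0

/-- The error probability of the gate in `initOne` is `0`. -/
theorem initOne_sem (q : Fin 2) : (initOne q).sem = (initOne q).ideal.sem := by
  simp [initOne, NoisyProg.sem, NoisyProg.ideal, Prog.sem]

theorem isSuperop_ideal_initOne (q : Fin 2) : IsSuperop (initOne q).ideal.sem :=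
  (isSuperop_conj_unitary _ _).comp (isSuperop_initSem q)

theorem isRobust_qbf :
    (qbf p pV pU ΦV ΦU).IsRobust 1 0
      (4 * gateError (gateV p) pV ΦV + 2 * gateError gateU pU ΦU) := by
  have hV := gateError_nonneg (gateV p) pV ΦV
  have hU := gateError_nonneg gateU pU ΦU
  refine ⟨by positivity, ?_⟩
  simp only [qDiamondDist, iSup_le_iff]
  rintro A _ _ ρ ⟨hρ, htr, -⟩
  refine ENNReal.ofReal_le_ofReal ?_
  -- the initialization, which is the same in the noisy and the ideal program
  set I : Op 2 →ₗ[ℂ] Op 2 := (initOne 1).ideal.sem ∘ₗ (initOne 0).ideal.sem with hI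
  have hIs : IsSuperop I := (isSuperop_ideal_initOne 1).comp (isSuperop_ideal_initOne 0)
  have hM : (liftOp (reg₁ 1) (proj 0) : Op 2)ᴴ * liftOp (reg₁ 1) (proj 0) + qbfM₁ᴴ * qbfM₁ = 1 := by
    rw [qbfM₁, ← liftOp_conjTranspose, ← liftOp_conjTranspose, ← liftOp_mul, ← liftOp_mul,
      ← liftOp_add, proj_complete, liftOp_one]
  have h := traceNorm_ampl_whileSem_sub_le (a := 1 / 2) hM
    (isSuperop_ideal_qbfBody p pV pU ΦV ΦU) (isSuperop_qbfBody p pV pU ΦV ΦU) (by norm_num)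
    (by positivity) (distLE_qbfBody p pV pU ΦV ΦU)
    (fun σ _ => le_of_eq (by
      rw [trace_guard_loopStep]
      have : (1 / 2 : ℂ) = ((1 / 2 : ℝ) : ℂ) := by push_cast; rfl
      rw [this, Complex.re_ofReal_mul]))
    (hIs.completely_positive A ρ hρ)
  have hle := hIs.trace_ampl_le hρ
  rw [htr, Complex.one_re] at hle
  have hnoisy : ampl A (qbf p pV pU ΦV ΦU).sem ρ =
      ampl A (whileSem (liftOp (reg₁ 1) (proj 0)) qbfM₁ (qbfBody p pV pU ΦV ΦU).sem)
        (ampl A I ρ) := by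
    rw [hI, ← initOne_sem, ← initOne_sem]
    rfl
  have hideal : ampl A (qbf p pV pU ΦV ΦU).ideal.sem ρ =
      ampl A (whileSem (liftOp (reg₁ 1) (proj 0)) qbfM₁ (qbfBody p pV pU ΦV ΦU).ideal.sem)
        (ampl A I ρ) := rfl
  rw [traceDist, hnoisy, hideal]
  have hc : 2 * (2 * gateError (gateV p) pV ΦV + gateError gateU pU ΦU) / (1 - 1 / 2) =
      2 * (4 * gateError (gateV p) pV ΦV + 2 * gateError gateU pU ΦU) := by ring
  rw [hc] at h
  have hfin := h.trans (mul_le_mul_of_nonneg_left hle (by positivity))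
  linarith

end BernoulliFactory

end QWhile

theorem mainTheorem4 (p pV pU : unitInterval)
    (ΦV : QWhile.Superoperator (QWhile.Qubits 1)) (ΦU : QWhile.Superoperator (QWhile.Qubits 2)) :
    QWhile.dual (QWhile.loopStep QWhile.qbfM₁ (QWhile.qbfBody p pV pU ΦV ΦU).ideal.sem)
        (QWhile.qbfM₁.conjTranspose * QWhile.qbfM₁) =
      (1 / 2 : ℂ) • (QWhile.qbfM₁.conjTranspose * QWhile.qbfM₁) ∧
    (QWhile.qbfLoop p pV pU ΦV ΦU).ideal.IsBounded (1 / 2) 1 ∧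
    (QWhile.qbf p pV pU ΦV ΦU).IsRobust 1 0
      (4 * QWhile.gateError (QWhile.gateV p) pV ΦV + 2 * QWhile.gateError QWhile.gateU pU ΦU) := by
  exact ⟨QWhile.dual_loopStep_qbf p pV pU ΦV ΦU, QWhile.isBounded_qbfLoop p pV pU ΦV ΦU,
    QWhile.isRobust_qbf p pV pU ΦV ΦU⟩
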